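/- Let $K\ge 2$, $\varepsilon_0>0$ and $\mu\in\mathbb R^K$. Put $\mu_\star=\max_k\mu_k$, and let $0=\Delta_1<\Delta_2<\dots<\Delta_{C_\mu}$ be the distinct values of the gaps $\mu_\star-\mu_k$; write $\Delta_{\min}=\Delta_2$, $\mathcal C(i)=\{k:\mu_\star-\mu_k=\Delta_i\}$, $i^\star=\mathcal C(1)$, and $\mathcal I_\varepsilon(\mu)=\{k:\mu_k\ge\mu_\star-\varepsilon\}$. **Complexities.** Let $c_i=2\Delta_i^{-1}-\varepsilon_0^{-1}$ and $c_{i,j}=2\frac{\Delta_j/\varepsilon_0+1}{\Delta_i-\Delta_j}+3\varepsilon_0^{-1}$. For $1\le j\le i\le C_\mu-1$ let $$\bar H_{i,j}=|i^\star|\max\{\sqrt2\,\Delta_{j+1}^{-1},c_{i+1,j}\}^2+\max\{c_{j+1},c_{i+1,j}\}^2\Big(\sum_{k=2}^{j}|\mathcal C(k)|+\sum_{k=i+1}^{C_\mu}|\mathcal C(k)|\Big)+\sum_{k=j+1}^{i}|\mathcal C(k)|\max\{c_{j+1},c_{i+1,j},\sqrt2\,\Delta_k^{-1}\}^2,$$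 $$\tilde H_{i,j}=\frac{2|i^\star|}{\Delta_{j+1}^2}+\max\{c_{j+1},\varepsilon_0^{-1}\}^2\sum_{k=2}^{j}|\mathcal C(k)|+\frac{2\sum_{k=1}^{j}|\mathcal C(k)|}{(\Delta_{i+1}-\Delta_j)^2}+\sum_{k=j+1}^{C_\mu}|\mathcal C(k)|\max\{c_{j+1},\varepsilon_0^{-1},\sqrt2\,\Delta_k^{-1}\}^2,$$ $$H^\circ_i=\min_{1\le j\le i}\max\{\bar H_{i,j},\tilde H_{i,j}\},\qquad U_i=K\min_{1\le j\le i}\max\{2\Delta_{j+1}^{-1},c_{i+1,j}\}^2,\qquad H_i(\mu,\varepsilon_0)=\min\{H^\circ_i,U_i\}.$$ **Algorithm.** In a bandit with reward distributions $\nu_1,\dots,\nu_K$, at each round $t\ge1$ an arm $I_t$ is chosen from the past (and possibly extra randomness used to break ties), and given all this the reward $X_t$ has law $\nu_{I_t}$. EB-TC$_{\varepsilon_0}$ with fixed proportions $\beta=1/2$ first pulls each arm once. Let $N_{n,i}$ be the number of pulls of arm $i$ before round $n$, and $\mu_{n,i}$ the mean of its rewards. At each $n>K$ it takes a leader $B_n=\hat\imath_n\in\arg\max_i\mu_{n,i}$,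 which is also the recommended arm, and a challenger $C_n\in\arg\min_{i\ne B_n}\frac{\mu_{n,B_n}-\mu_{n,i}+\varepsilon_0}{\sqrt{1/N_{n,B_n}+1/N_{n,i}}}$ (ties broken arbitrarily). With $T_{n+1}$ the number of rounds $t\in\{K+1,\dots,n\}$ with $(B_t,C_t)=(B_n,C_n)$, and $N'$ the number of rounds $t\in\{K+1,\dots,n-1\}$ with $(B_t,C_t)=(B_n,C_n)$ and $I_t=C_t$, it pulls $I_n=C_n$ if $N'\le\frac12T_{n+1}$, and $I_n=B_n$ otherwise. **Theorem.** 1. If $C_\mu\ge2$, then $H_1(\mu,\varepsilon_0)=H_1^\circ=K(2\Delta_{\min}^{-1}+3\varepsilon_0^{-1})^2$. For all $1<i<C_\mu$, $$K\Delta_{i+1}^{-2}\le H_i(\mu,\varepsilon_0)\le K\min_{1\le j\le i}\max\Big\{2\Delta_{j+1}^{-1},\ 2\tfrac{\Delta_j/\varepsilon_0+1}{\Delta_{i+1}-\Delta_j}+3\varepsilon_0^{-1}\Big\}^2,\qquad H_i(\mu,\varepsilon_0)\le H^\circ_i\le\tfrac32H_i(\mu,\varepsilon_0).$$ 2. Let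 $\nu_1,\dots,\nu_K$ be $1$-sub-Gaussian (that is, $\mathbb E_{X\sim\nu_k}e^{\lambda(X-\mathbb EX)}\le e^{\lambda^2/2}$ for all $\lambda\in\mathbb R$) with means $\mu_1,\dots,\mu_K$. For all $\varepsilon\ge0$ and all $n>5K^2/2$: if $\varepsilon\in[\Delta_i,\Delta_{i+1})$ with $1\le i<C_\mu$, which is the meaning of $i_\mu(\varepsilon)=i$, then $$\mathbb P_\nu(\hat\imath_n\notin\mathcal I_\varepsilon(\mu))\le K^2e^2(2+\log n)^2\exp\Big(-p\Big(\frac{n-5K^2/2}{8H_i(\mu,\varepsilon_0)}\Big)\Big),$$ where $p(x)=x-\log x$ for $x\ge1$ and $p(x)=1$ for $x\le1$; if $\varepsilon\ge\Delta_{C_\mu}$, then $\mathbb P_\nu(\hat\imath_n\notin\mathcal I_\varepsilon(\mu))=0$. -/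

import Mathlib

open MeasureTheory ProbabilityTheory

namespace EBTC

noncomputable section

/-! ### Bandit instances: means, gaps, good arms -/

/-- A distribution on the reals is `1`-sub-Gaussian:
`E[exp (s (X - E X))] ≤ exp (s ^ 2 / 2)` for all real `s` (all these expectations being finite). -/
def IsOneSubGaussian (ρ : Measure ℝ) : Prop :=
  HasSubgaussianMGF (fun x : ℝ => x - ∫ y, y ∂ρ) 1 ρ

variable {K : ℕ}

/-- The largest mean. -/
def bestMean (μ : Fin K → ℝ) : ℝ := ⨆ k, μ k

/-- The set of `ε`-good arms. -/
def goodArms (μ : Fin K → ℝ) (ε : ℝ) : Set (Fin K) := {k | bestMean μ - ε ≤ μ k}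

/-- The finite set of the distinct gaps `bestMean μ - μ k`. -/
def gapSet (μ : Fin K → ℝ) : Finset ℝ := Finset.univ.image fun k => bestMean μ - μ k

/-- The number of distinct gaps, i.e. of distinct means. -/
def numGroups (μ : Fin K → ℝ) : ℕ := (gapSet μ).card

/-- The `i`-th smallest distinct gap, `0 = gap μ 1 < gap μ 2 < ⋯ < gap μ (numGroups μ)`
(the index `i` starts at `1`; the value is meaningless outside `1 ≤ i ≤ numGroups μ`). -/
def gap (μ : Fin K → ℝ) (i : ℕ) : ℝ := (gapSet μ).sort.getD (i - 1) 0

/-- The number of arms whose gap is the `i`-th smallest distinct gap. -/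
def groupCard (μ : Fin K → ℝ) (i : ℕ) : ℕ :=
  (Finset.univ.filter fun k => bestMean μ - μ k = gap μ i).card

/-- The number of best arms. -/
def numBest (μ : Fin K → ℝ) : ℕ := (Finset.univ.filter fun k => μ k = bestMean μ).card

/-! ### Complexities -/

/-- `C_i = 2 / Δ_i - 1 / ε₀`. -/
def cOne (μ : Fin K → ℝ) (ε₀ : ℝ) (i : ℕ) : ℝ := 2 * (gap μ i)⁻¹ - ε₀⁻¹

/-- `C_{i,j} = 2 (Δ_j / ε₀ + 1) / (Δ_i - Δ_j) + 3 / ε₀`. -/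
def cTwo (μ : Fin K → ℝ) (ε₀ : ℝ) (i j : ℕ) : ℝ :=
  2 * ((gap μ j / ε₀ + 1) / (gap μ i - gap μ j)) + 3 * ε₀⁻¹

/-- The first pairwise complexity. -/
def hBar (μ : Fin K → ℝ) (ε₀ : ℝ) (i j : ℕ) : ℝ :=
  (numBest μ : ℝ) * (max (√2 * (gap μ (j + 1))⁻¹) (cTwo μ ε₀ (i + 1) j)) ^ 2
  + (max (cOne μ ε₀ (j + 1)) (cTwo μ ε₀ (i + 1) j)) ^ 2
      * (∑ k ∈ Finset.Icc 2 j, (groupCard μ k : ℝ)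
          + ∑ k ∈ Finset.Icc (i + 1) (numGroups μ), (groupCard μ k : ℝ))
  + ∑ k ∈ Finset.Icc (j + 1) i, (groupCard μ k : ℝ)
      * (max (max (cOne μ ε₀ (j + 1)) (cTwo μ ε₀ (i + 1) j)) (√2 * (gap μ k)⁻¹)) ^ 2

/-- The second pairwise complexity. -/
def hTilde (μ : Fin K → ℝ) (ε₀ : ℝ) (i j : ℕ) : ℝ :=
  2 * (numBest μ : ℝ) / (gap μ (j + 1)) ^ 2
  + (max (cOne μ ε₀ (j + 1)) ε₀⁻¹) ^ 2 * ∑ k ∈ Finset.Icc 2 j, (groupCard μ k : ℝ)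
  + 2 * (∑ k ∈ Finset.Icc 1 j, (groupCard μ k : ℝ)) / (gap μ (i + 1) - gap μ j) ^ 2
  + ∑ k ∈ Finset.Icc (j + 1) (numGroups μ), (groupCard μ k : ℝ)
      * (max (max (cOne μ ε₀ (j + 1)) ε₀⁻¹) (√2 * (gap μ k)⁻¹)) ^ 2

/-- The detailed complexity `min_{1 ≤ j ≤ i} max (hBar i j) (hTilde i j)`. -/
def detailedComplexity (μ : Fin K → ℝ) (ε₀ : ℝ) (i : ℕ) : ℝ :=
  ⨅ j : Finset.Icc 1 i, max (hBar μ ε₀ i j) (hTilde μ ε₀ i j)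

/-- The simplified complexity
`K min_{1 ≤ j ≤ i} (max (2 / Δ_{j+1}) (2 (Δ_j / ε₀ + 1) / (Δ_{i+1} - Δ_j) + 3 / ε₀)) ^ 2`. -/
def simpleComplexity (μ : Fin K → ℝ) (ε₀ : ℝ) (i : ℕ) : ℝ :=
  (K : ℝ) * ⨅ j : Finset.Icc 1 i,
    (max (2 * (gap μ ((j : ℕ) + 1))⁻¹) (cTwo μ ε₀ (i + 1) j)) ^ 2

/-- The complexity `H_i(μ, ε₀)`: the detailed one, capped by the simplified one. -/
def complexity (μ : Fin K → ℝ) (ε₀ : ℝ) (i : ℕ) : ℝ :=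
  min (detailedComplexity μ ε₀ i) (simpleComplexity μ ε₀ i)

/-- `p(x) = x - log x` for `x ≥ 1`, and `p(x) = 1` for `x ≤ 1`. -/
def pFun (x : ℝ) : ℝ := max x 1 - Real.log (max x 1)

/-! ### The algorithm

A trajectory consists of the sequences `arm` (arm pulled at round `t`), `rew` (reward received at
round `t`), `lead` and `chal` (leader and challenger at round `t`). Rounds are `t = 1, 2, …`; the
first `K` rounds are the initialization, which has no leader and no challenger. -/

/-- `N_{n,i}`: number of pulls of arm `i` before round `n`. -/
def pulls (arm : ℕ → Fin K) (n : ℕ) (i : Fin K) : ℕ :=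
  ((Finset.Ico 1 n).filter fun t => arm t = i).card

/-- `μ_{n,i}`: empirical mean of arm `i` before round `n`. -/
def empMean (arm : ℕ → Fin K) (rew : ℕ → ℝ) (n : ℕ) (i : Fin K) : ℝ :=
  (∑ t ∈ (Finset.Ico 1 n).filter (fun t => arm t = i), rew t) / (pulls arm n i : ℝ)

/-- `T_n(i,j)`: number of rounds before `n` with leader `i` and challenger `j`. -/
def pairCount (lead chal : ℕ → Fin K) (n : ℕ) (i j : Fin K) : ℕ :=
  ((Finset.Ico (K + 1) n).filter fun t => lead t = i ∧ chal t = j).card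

/-- `N^i_{n,j}`: number of rounds before `n` with leader `i` and challenger `j` in which the
challenger `j` was pulled. -/
def chalPulls (arm lead chal : ℕ → Fin K) (n : ℕ) (i j : Fin K) : ℕ :=
  ((Finset.Ico (K + 1) n).filter fun t => (lead t = i ∧ chal t = j) ∧ arm t = j).card

/-- The empirical transportation cost with slack `ε₀`, of leader `i` against arm `j`. -/
def transportCost (ε₀ : ℝ) (arm : ℕ → Fin K) (rew : ℕ → ℝ) (n : ℕ) (i j : Fin K) : ℝ :=
  (empMean arm rew n i - empMean arm rew n j + ε₀)
    / √(1 / (pulls arm n i : ℝ) + 1 / (pulls arm n j : ℝ))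

/-- The trajectory follows EB-TC with slack `ε₀` and fixed proportions `β`; ties in the choice of
the leader and of the challenger are broken arbitrarily. The leader `lead n` is also the arm
recommended at time `n > K`. -/
structure Follows (ε₀ β : ℝ) (arm : ℕ → Fin K) (rew : ℕ → ℝ) (lead chal : ℕ → Fin K) :
    Prop where
  /-- Each arm is pulled once during the first `K` rounds. -/
  init : ∀ i, pulls arm (K + 1) i = 1
  /-- The leader is an empirical best arm. -/
  lead_best : ∀ n, K < n → ∀ i, empMean arm rew n i ≤ empMean arm rew n (lead n)
  chal_ne : ∀ n, K < n → chal n ≠ lead n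
  /-- The challenger minimizes the transportation cost. -/
  chal_min : ∀ n, K < n → ∀ i, i ≠ lead n →
    transportCost ε₀ arm rew n (lead n) (chal n) ≤ transportCost ε₀ arm rew n (lead n) i
  /-- Tracking: which of the two is pulled. -/
  track : ∀ n, K < n → arm n =
    if (chalPulls arm lead chal n (lead n) (chal n) : ℝ)
        ≤ (1 - β) * (pairCount lead chal (n + 1) (lead n) (chal n) : ℝ)
    then chal n else lead n

/-- The algorithm EB-TC with slack `ε₀` and fixed proportions `β`, interacting with the bandit
instance `ν` on the probability space `(Ω, P)`. The `σ`-algebra `ℱ t` is the information available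
when the arm of round `t` has been chosen and its reward is still to be drawn: it contains the
history before `t`, and possibly the randomness used to break ties. -/
structure Interaction (ε₀ β : ℝ) (ν : Fin K → Measure ℝ) {Ω : Type*} [mΩ : MeasurableSpace Ω]
    (P : Measure Ω) (ℱ : Filtration ℕ mΩ) (arm : ℕ → Ω → Fin K) (rew : ℕ → Ω → ℝ)
    (lead chal : ℕ → Ω → Fin K) : Prop where
  arm_meas : ∀ t, 1 ≤ t → Measurable[ℱ t] (arm t)
  lead_meas : ∀ t, K < t → Measurable[ℱ t] (lead t)
  chal_meas : ∀ t, K < t → Measurable[ℱ t] (chal t)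
  rew_meas : ∀ t, 1 ≤ t → Measurable[ℱ (t + 1)] (rew t)
  /-- Given `ℱ t`, the reward of round `t` is distributed according to `ν` at the pulled arm. -/
  rew_law : ∀ t, 1 ≤ t → ∀ A : Set ℝ, MeasurableSet A →
    P⟦rew t ⁻¹' A | ℱ t⟧ =ᵐ[P] fun ω => (ν (arm t ω)).real A
  follows : ∀ ω, Follows ε₀ β (fun t => arm t ω) (fun t => rew t ω)
    (fun t => lead t ω) (fun t => chal t ω)

end

end EBTC

/-!
The three complexities are compared group by group. The coefficient of every arm in `hBar i j` is
at least `baseCoeff i j ^ 2`, with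
`baseCoeff i j = max (√2 / Δ_{j+1}) (2 (Δ_j / ε₀ + 1) / (Δ_{i+1} - Δ_j) + 3 / ε₀)`, and so is the
coefficient in the simplified complexity. Hence `complexity i` is at least `K * baseCoeff i j ^ 2`
for some `1 ≤ j ≤ i` (`exists_base_le_complexity`), and this is all that the error bound needs.
The upper bounds on `hBar` and `hTilde` give `detailedComplexity ≤ 3 / 2 * complexity`.

The error bound combines a concentration inequality with a deterministic counting argument.

*Counting.* The tracking rule pulls the challenger of a pair in half of the rounds in which the
pair is selected, up to one, so an arm which is leader or challenger in `T` rounds is pulled at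
least `T / 2 - (K - 1)` times. If in every round before `n` the leader or the challenger has been
pulled at most `D` times so far, then `n ≤ 2 K D + 2 K ^ 2 + 1` (`Follows.horizon_le`).

*A late error forces undersampling.* Suppose that at level `x` the deviations of all pairs of arms
are controlled (`Concentrated`), and that the leader `k` at time `n` is not good. Put
`D = 4 x * baseCoeff i j ^ 2`. Since `k` beats empirically every arm of the groups up to `j`, either
`k` is undersampled at time `n`, hence at all rounds before, or all arms of these groups are. In the
first case the transportation cost of `k` is small at all earlier rounds; since the cost of the
challenger is the smallest one, and is at least `ε₀` divided by the width of the pair, the leader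
or the challenger was pulled at most `D` times. In the second case the same argument applies to a
best arm whenever the leader is not one of the undersampled arms. So `D` is a valid threshold in
the counting argument, which gives `n < 8 * complexity i * x + 5 K ^ 2 / 2` (`Follows.lt_of_bad`).

*Concentration.* For each arm, a uniform mixture over about `log n / log 4` Gaussian mixtures of
the exponential martingales of the centred rewards is a nonnegative supermartingale (`gaussMix`),
and so is the product for two arms, because a round moves only one of them. The maximal inequality
`mul_measure_exists_ge_le` controls the pairs uniformly in time. The constants of the deterministic
part leave enough room for the loss of a factor `3 / 2` in the exponent.
-/

namespace EBTC

/-! ### The distinct gaps -/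

section Gaps

variable {K : ℕ} {μ : Fin K → ℝ}

lemma le_bestMean (μ : Fin K → ℝ) (k : Fin K) : μ k ≤ bestMean μ :=
  le_ciSup (Set.finite_range μ).bddAbove k

lemma exists_eq_bestMean [Nonempty (Fin K)] (μ : Fin K → ℝ) : ∃ k, μ k = bestMean μ :=
  exists_eq_ciSup_of_finite

lemma gap_eq_getElem {i : ℕ} (hi : 1 ≤ i) (hi' : i ≤ numGroups μ) :
    ∃ h : i - 1 < (gapSet μ).sort.length, gap μ i = (gapSet μ).sort[i - 1] := by
  have h : i - 1 < (gapSet μ).sort.length := by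
    rw [Finset.length_sort]; change i - 1 < numGroups μ; omega
  exact ⟨h, by simp [gap, List.getD_eq_getElem?_getD, List.getElem?_eq_getElem h]⟩

lemma gap_mem {i : ℕ} (hi : 1 ≤ i) (hi' : i ≤ numGroups μ) : gap μ i ∈ gapSet μ := by
  obtain ⟨h, e⟩ := gap_eq_getElem hi hi'
  rw [e, ← Finset.mem_sort (· ≤ ·)]
  exact List.getElem_mem h

lemma gap_lt_gap {i j : ℕ} (hi : 1 ≤ i) (hij : i < j) (hj : j ≤ numGroups μ) :
    gap μ i < gap μ j := by
  obtain ⟨h, e⟩ := gap_eq_getElem hi (hij.le.trans hj)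
  obtain ⟨h', e'⟩ := gap_eq_getElem (hi.trans hij.le) hj
  rw [e, e']
  exact (Finset.sortedLT_sort (gapSet μ)).strictMono_get (a := ⟨i - 1, h⟩) (b := ⟨j - 1, h'⟩)
    (Fin.mk_lt_mk.2 (by omega))

lemma gap_le_gap {i j : ℕ} (hi : 1 ≤ i) (hij : i ≤ j) (hj : j ≤ numGroups μ) :
    gap μ i ≤ gap μ j := by
  rcases hij.eq_or_lt with rfl | h
  · rfl
  · exact (gap_lt_gap hi h hj).le

lemma exists_gap_eq (μ : Fin K → ℝ) (k : Fin K) :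
    ∃ i, 1 ≤ i ∧ i ≤ numGroups μ ∧ bestMean μ - μ k = gap μ i := by
  have hk : bestMean μ - μ k ∈ (gapSet μ).sort := by
    rw [Finset.mem_sort]; exact Finset.mem_image_of_mem _ (Finset.mem_univ k)
  obtain ⟨m, hm, e⟩ := List.mem_iff_getElem.1 hk
  have hm' : m < numGroups μ := by rwa [Finset.length_sort] at hm
  refine ⟨m + 1, by omega, by omega, ?_⟩
  obtain ⟨h, e'⟩ := gap_eq_getElem (μ := μ) (i := m + 1) (by omega) (by omega)
  rw [e', ← e]; rfl

lemma numGroups_pos [Nonempty (Fin K)] (μ : Fin K → ℝ) : 1 ≤ numGroups μ := by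
  obtain ⟨i, h1, h2, -⟩ := exists_gap_eq μ (Classical.arbitrary _)
  exact h1.trans h2

lemma gap_nonneg {i : ℕ} (hi : 1 ≤ i) (hi' : i ≤ numGroups μ) : 0 ≤ gap μ i := by
  obtain ⟨k, -, e⟩ := Finset.mem_image.1 (gap_mem hi hi')
  rw [← e]; exact sub_nonneg.2 (le_bestMean μ k)

lemma gap_one [Nonempty (Fin K)] (μ : Fin K → ℝ) : gap μ 1 = 0 := by
  obtain ⟨k, hk⟩ := exists_eq_bestMean μ
  obtain ⟨i, h1, h2, e⟩ := exists_gap_eq μ k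
  refine le_antisymm ?_ (gap_nonneg le_rfl (numGroups_pos μ))
  calc gap μ 1 ≤ gap μ i := gap_le_gap le_rfl h1 h2
    _ = 0 := by rw [← e, hk, sub_self]

lemma gap_pos [Nonempty (Fin K)] {i : ℕ} (hi : 2 ≤ i) (hi' : i ≤ numGroups μ) :
    0 < gap μ i := by
  rw [← gap_one μ]; exact gap_lt_gap le_rfl hi hi'

lemma gap_succ_le {i : ℕ} {k : Fin K} (h : gap μ i < bestMean μ - μ k) (hi : i ≤ numGroups μ) :
    gap μ (i + 1) ≤ bestMean μ - μ k := by
  obtain ⟨m, h1, h2, e⟩ := exists_gap_eq μ k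
  rw [e] at h ⊢
  refine gap_le_gap (by omega) ?_ h2
  by_contra! hc
  exact absurd (gap_le_gap h1 (Nat.lt_succ_iff.1 hc) hi) (not_le.2 h)

lemma sub_le_gap_last (μ : Fin K → ℝ) (k : Fin K) :
    bestMean μ - μ k ≤ gap μ (numGroups μ) := by
  obtain ⟨i, h1, h2, e⟩ := exists_gap_eq μ k
  rw [e]; exact gap_le_gap h1 h2 le_rfl

lemma groupCard_one [Nonempty (Fin K)] (μ : Fin K → ℝ) : groupCard μ 1 = numBest μ := by
  unfold groupCard numBest
  rw [gap_one]
  congr 1; ext k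
  simp only [Finset.mem_filter, sub_eq_zero, eq_comm]

lemma sum_groupCard (μ : Fin K → ℝ) :
    ∑ i ∈ Finset.Icc 1 (numGroups μ), groupCard μ i = K := by
  have key : ∀ k : Fin K,
      ∑ i ∈ Finset.Icc 1 (numGroups μ), (if bestMean μ - μ k = gap μ i then 1 else 0) = 1 := by
    intro k
    obtain ⟨i, h1, h2, e⟩ := exists_gap_eq μ k
    rw [Finset.sum_eq_single_of_mem i (Finset.mem_Icc.2 ⟨h1, h2⟩), if_pos e]
    intro j hj hji
    refine if_neg fun h => ?_
    obtain ⟨j1, j2⟩ := Finset.mem_Icc.1 hj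
    rw [e] at h
    rcases lt_or_gt_of_ne hji with hl | hl
    · exact (gap_lt_gap j1 hl h2).ne' h
    · exact (gap_lt_gap h1 hl j2).ne h
  simp only [groupCard, Finset.card_filter]
  rw [Finset.sum_comm, Finset.sum_congr rfl fun k _ => key k]
  simp

/-- The arms split into the best ones and the groups `2, …, j`, `j + 1, …, i`,
`i + 1, …, numGroups μ`. -/
lemma groupCard_split [Nonempty (Fin K)] {i j : ℕ} (hj : 1 ≤ j) (hji : j ≤ i)
    (hi : i ≤ numGroups μ) :
    (numBest μ : ℝ) + ∑ k ∈ Finset.Icc 2 j, (groupCard μ k : ℝ)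
      + ∑ k ∈ Finset.Icc (j + 1) i, (groupCard μ k : ℝ)
      + ∑ k ∈ Finset.Icc (i + 1) (numGroups μ), (groupCard μ k : ℝ) = K := by
  have e : ∀ a b, Finset.Icc (a + 1) b = Finset.Ioc a b := fun a b => by
    ext; simp
  have h := congrArg (Nat.cast : ℕ → ℝ) (sum_groupCard μ)
  push_cast at h
  rw [← h, ← groupCard_one, e 1 j, e j i, e i, e 0,
    ← Finset.sum_Ioc_consecutive (fun k => (groupCard μ k : ℝ)) (Nat.zero_le i) hi,
    ← Finset.sum_Ioc_consecutive (fun k => (groupCard μ k : ℝ)) (Nat.zero_le j) hji,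
    ← Finset.sum_Ioc_consecutive (fun k => (groupCard μ k : ℝ)) (Nat.zero_le 1) hj]
  simp

end Gaps

/-! ### Comparison of the complexities -/

section Complexity

variable {K : ℕ} {μ : Fin K → ℝ} {ε₀ : ℝ}

/-- The common lower bound for the square roots of the coefficients of the arms in `hBar μ ε₀ i j`
and of the coefficient in `simpleComplexity μ ε₀ i`. -/
noncomputable def baseCoeff (μ : Fin K → ℝ) (ε₀ : ℝ) (i j : ℕ) : ℝ :=
  max (√2 * (gap μ (j + 1))⁻¹) (cTwo μ ε₀ (i + 1) j)

lemma sqrt_two_le : √2 ≤ 3 / 2 := by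
  rw [Real.sqrt_le_left (by norm_num)]; norm_num

lemma three_inv_le_cTwo {i j : ℕ} (hε₀ : 0 < ε₀) (hj : 1 ≤ j) (hji : j < i)
    (hi : i ≤ numGroups μ) : 3 * ε₀⁻¹ ≤ cTwo μ ε₀ i j := by
  have h1 := gap_nonneg (μ := μ) hj (hji.le.trans hi)
  have h2 := sub_pos.2 (gap_lt_gap (μ := μ) hj hji hi)
  unfold cTwo
  have : 0 ≤ 2 * ((gap μ j / ε₀ + 1) / (gap μ i - gap μ j)) := by positivity
  linarith

lemma two_inv_le_cTwo {i j : ℕ} (hε₀ : 0 < ε₀) (hj : 1 ≤ j) (hji : j < i)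
    (hi : i ≤ numGroups μ) : 2 * (gap μ i - gap μ j)⁻¹ ≤ cTwo μ ε₀ i j := by
  have h1 := gap_nonneg (μ := μ) hj (hji.le.trans hi)
  have h2 := sub_pos.2 (gap_lt_gap (μ := μ) hj hji hi)
  unfold cTwo
  have h3 : (gap μ i - gap μ j)⁻¹ ≤ (gap μ j / ε₀ + 1) / (gap μ i - gap μ j) := by
    rw [inv_eq_one_div]
    gcongr
    have : 0 ≤ gap μ j / ε₀ := by positivity
    linarith
  have : 0 < ε₀⁻¹ := by positivity
  linarith

/-- If `2 / Δ - 1 / ε₀ ≤ m` and `3 / ε₀ ≤ m`, then `(3 / 2) / Δ ≤ m`, hence `√2 / Δ ≤ m`. -/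
lemma baseCoeff_le_max [Nonempty (Fin K)] {i j : ℕ} (hε₀ : 0 < ε₀) (hj : 1 ≤ j) (hji : j ≤ i)
    (hi : i < numGroups μ) :
    baseCoeff μ ε₀ i j ≤ max (cOne μ ε₀ (j + 1)) (cTwo μ ε₀ (i + 1) j) := by
  set m := max (cOne μ ε₀ (j + 1)) (cTwo μ ε₀ (i + 1) j)
  have h1 : cOne μ ε₀ (j + 1) ≤ m := le_max_left _ _
  have h2 : cTwo μ ε₀ (i + 1) j ≤ m := le_max_right _ _
  have h3 := three_inv_le_cTwo (μ := μ) hε₀ hj (Nat.lt_succ_of_le hji) hi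
  have h4 : 0 < (gap μ (j + 1))⁻¹ := inv_pos.2 (gap_pos (by omega) (by omega))
  have h5 := mul_le_mul_of_nonneg_right sqrt_two_le h4.le
  refine max_le ?_ h2
  unfold cOne at h1
  linarith

lemma baseCoeff_pos {i j : ℕ} (hε₀ : 0 < ε₀) (hj : 1 ≤ j) (hji : j ≤ i)
    (hi : i < numGroups μ) : 0 < baseCoeff μ ε₀ i j := by
  have h3 := three_inv_le_cTwo (μ := μ) hε₀ hj (Nat.lt_succ_of_le hji) hi
  have : 0 < ε₀⁻¹ := by positivity
  exact lt_of_lt_of_le (by linarith) (le_max_right _ _)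

lemma base_le_hBar [Nonempty (Fin K)] {i j : ℕ} (hε₀ : 0 < ε₀) (hj : 1 ≤ j) (hji : j ≤ i)
    (hi : i < numGroups μ) : (K : ℝ) * baseCoeff μ ε₀ i j ^ 2 ≤ hBar μ ε₀ i j := by
  have hm := baseCoeff_le_max (μ := μ) hε₀ hj hji hi
  have h0 := (baseCoeff_pos (μ := μ) hε₀ hj hji hi).le
  have hsq := pow_le_pow_left₀ h0 hm 2
  rw [← groupCard_split (μ := μ) hj hji hi.le]
  have hA : 0 ≤ ∑ k ∈ Finset.Icc 2 j, (groupCard μ k : ℝ) := by positivity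
  have hB : 0 ≤ ∑ k ∈ Finset.Icc (i + 1) (numGroups μ), (groupCard μ k : ℝ) := by positivity
  have hC : (∑ k ∈ Finset.Icc (j + 1) i, (groupCard μ k : ℝ)) * baseCoeff μ ε₀ i j ^ 2
      ≤ ∑ k ∈ Finset.Icc (j + 1) i, (groupCard μ k : ℝ)
        * (max (max (cOne μ ε₀ (j + 1)) (cTwo μ ε₀ (i + 1) j)) (√2 * (gap μ k)⁻¹)) ^ 2 := by
    rw [Finset.sum_mul]
    refine Finset.sum_le_sum fun k _ => mul_le_mul_of_nonneg_left ?_ (by positivity)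
    exact pow_le_pow_left₀ h0 (hm.trans (le_max_left _ _)) 2
  have hAB := mul_le_mul_of_nonneg_right hsq (add_nonneg hA hB)
  have e : hBar μ ε₀ i j = (numBest μ : ℝ) * baseCoeff μ ε₀ i j ^ 2
    + (max (cOne μ ε₀ (j + 1)) (cTwo μ ε₀ (i + 1) j)) ^ 2
      * (∑ k ∈ Finset.Icc 2 j, (groupCard μ k : ℝ)
          + ∑ k ∈ Finset.Icc (i + 1) (numGroups μ), (groupCard μ k : ℝ))
    + ∑ k ∈ Finset.Icc (j + 1) i, (groupCard μ k : ℝ)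
      * (max (max (cOne μ ε₀ (j + 1)) (cTwo μ ε₀ (i + 1) j)) (√2 * (gap μ k)⁻¹)) ^ 2 := rfl
  rw [e]
  linarith

/-- The square root of the coefficient in `simpleComplexity μ ε₀ i`. -/
noncomputable def capCoeff (μ : Fin K → ℝ) (ε₀ : ℝ) (i j : ℕ) : ℝ :=
  max (2 * (gap μ (j + 1))⁻¹) (cTwo μ ε₀ (i + 1) j)

lemma baseCoeff_le_capCoeff [Nonempty (Fin K)] {i j : ℕ} (hj : 1 ≤ j) (hji : j ≤ i)
    (hi : i < numGroups μ) : baseCoeff μ ε₀ i j ≤ capCoeff μ ε₀ i j := by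
  have h4 : 0 < (gap μ (j + 1))⁻¹ := inv_pos.2 (gap_pos (by omega) (by omega))
  refine max_le_max ?_ le_rfl
  exact mul_le_mul_of_nonneg_right (sqrt_two_le.trans (by norm_num)) h4.le

lemma gap_inv_le [Nonempty (Fin K)] {j k : ℕ} (hj : 1 ≤ j) (hjk : j + 1 ≤ k)
    (hk : k ≤ numGroups μ) : √2 * (gap μ k)⁻¹ ≤ 2 * (gap μ (j + 1))⁻¹ := by
  have h1 : 0 < gap μ (j + 1) := gap_pos (by omega) (hjk.trans hk)
  have h2 := gap_le_gap (μ := μ) (by omega) hjk hk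
  have h3 : (gap μ k)⁻¹ ≤ (gap μ (j + 1))⁻¹ := inv_anti₀ h1 h2
  exact mul_le_mul (sqrt_two_le.trans (by norm_num)) h3 (inv_nonneg.2 (h1.le.trans h2))
    (by norm_num)

lemma cOne_le {j : ℕ} (hε₀ : 0 < ε₀) : cOne μ ε₀ j ≤ 2 * (gap μ j)⁻¹ := by
  have : 0 < ε₀⁻¹ := by positivity
  unfold cOne; linarith

lemma hBar_le_cap [Nonempty (Fin K)] {i j : ℕ} (hε₀ : 0 < ε₀) (hj : 1 ≤ j) (hji : j ≤ i)
    (hi : i < numGroups μ) : hBar μ ε₀ i j ≤ (K : ℝ) * capCoeff μ ε₀ i j ^ 2 := by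
  have h0 := (baseCoeff_pos (μ := μ) hε₀ hj hji hi).le
  have hm := baseCoeff_le_max (μ := μ) hε₀ hj hji hi
  have h1 : max (cOne μ ε₀ (j + 1)) (cTwo μ ε₀ (i + 1) j) ≤ capCoeff μ ε₀ i j :=
    max_le_max (cOne_le hε₀) le_rfl
  rw [← groupCard_split (μ := μ) hj hji hi.le]
  have hA : 0 ≤ ∑ k ∈ Finset.Icc 2 j, (groupCard μ k : ℝ) := by positivity
  have hB : 0 ≤ ∑ k ∈ Finset.Icc (i + 1) (numGroups μ), (groupCard μ k : ℝ) := by positivity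
  have hC : ∑ k ∈ Finset.Icc (j + 1) i, (groupCard μ k : ℝ)
        * (max (max (cOne μ ε₀ (j + 1)) (cTwo μ ε₀ (i + 1) j)) (√2 * (gap μ k)⁻¹)) ^ 2
      ≤ (∑ k ∈ Finset.Icc (j + 1) i, (groupCard μ k : ℝ)) * capCoeff μ ε₀ i j ^ 2 := by
    rw [Finset.sum_mul]
    refine Finset.sum_le_sum fun k hk => mul_le_mul_of_nonneg_left ?_ (by positivity)
    obtain ⟨k1, k2⟩ := Finset.mem_Icc.1 hk
    refine pow_le_pow_left₀ (h0.trans (hm.trans (le_max_left _ _))) (max_le h1 ?_) 2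
    exact (gap_inv_le hj k1 (k2.trans hi.le)).trans (le_max_left _ _)
  have hAB := mul_le_mul_of_nonneg_right (pow_le_pow_left₀ (h0.trans hm) h1 2) (add_nonneg hA hB)
  have hD := mul_le_mul_of_nonneg_left
    (pow_le_pow_left₀ h0 (baseCoeff_le_capCoeff (μ := μ) (ε₀ := ε₀) hj hji hi) 2)
    (Nat.cast_nonneg (α := ℝ) (numBest μ))
  have e : hBar μ ε₀ i j = (numBest μ : ℝ) * baseCoeff μ ε₀ i j ^ 2
    + (max (cOne μ ε₀ (j + 1)) (cTwo μ ε₀ (i + 1) j)) ^ 2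
      * (∑ k ∈ Finset.Icc 2 j, (groupCard μ k : ℝ)
          + ∑ k ∈ Finset.Icc (i + 1) (numGroups μ), (groupCard μ k : ℝ))
    + ∑ k ∈ Finset.Icc (j + 1) i, (groupCard μ k : ℝ)
      * (max (max (cOne μ ε₀ (j + 1)) (cTwo μ ε₀ (i + 1) j)) (√2 * (gap μ k)⁻¹)) ^ 2 := rfl
  rw [e]
  linarith

/-- The best arms appear in two terms of `hTilde`, each with a coefficient at most half of
`capCoeff ^ 2`. The groups `2, …, j` appear in two terms as well, with coefficients at most
`capCoeff ^ 2` and half of it, hence the extra term. -/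
lemma hTilde_le_cap [Nonempty (Fin K)] {i j : ℕ} (hε₀ : 0 < ε₀) (hj : 1 ≤ j) (hji : j ≤ i)
    (hi : i < numGroups μ) :
    hTilde μ ε₀ i j ≤ ((K : ℝ) + (∑ k ∈ Finset.Icc 2 j, (groupCard μ k : ℝ)) / 2)
      * capCoeff μ ε₀ i j ^ 2 := by
  have hM1 : 2 * (gap μ (j + 1))⁻¹ ≤ capCoeff μ ε₀ i j := le_max_left _ _
  have hM2 : cTwo μ ε₀ (i + 1) j ≤ capCoeff μ ε₀ i j := le_max_right _ _
  have hg : 0 < (gap μ (j + 1))⁻¹ := inv_pos.2 (gap_pos (by omega) (by omega))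
  have hd : 0 < (gap μ (i + 1) - gap μ j)⁻¹ :=
    inv_pos.2 (sub_pos.2 (gap_lt_gap hj (by omega) (by omega)))
  have h2 := two_inv_le_cTwo (μ := μ) hε₀ hj (Nat.lt_succ_of_le hji) hi
  have h3 := three_inv_le_cTwo (μ := μ) hε₀ hj (Nat.lt_succ_of_le hji) hi
  have hε : 0 < ε₀⁻¹ := by positivity
  have h1 : max (cOne μ ε₀ (j + 1)) ε₀⁻¹ ≤ capCoeff μ ε₀ i j :=
    max_le ((cOne_le hε₀).trans hM1) (by linarith)
  have h0 : 0 ≤ max (cOne μ ε₀ (j + 1)) ε₀⁻¹ := hε.le.trans (le_max_right _ _)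
  have sq1 := pow_le_pow_left₀ (by positivity) hM1 2
  have sq2 := pow_le_pow_left₀ (by positivity) (h2.trans hM2) 2
  have sq3 := pow_le_pow_left₀ h0 h1 2
  have hsplit := groupCard_split (μ := μ) hj (hji.trans hi.le) le_rfl
  rw [Finset.Icc_eq_empty (a := numGroups μ + 1) (by omega), Finset.sum_empty, add_zero] at hsplit
  have hsum1 : ∑ k ∈ Finset.Icc 1 j, (groupCard μ k : ℝ)
      = numBest μ + ∑ k ∈ Finset.Icc 2 j, (groupCard μ k : ℝ) := by
    rw [← Finset.add_sum_Ioc_eq_sum_Icc hj, groupCard_one]; rfl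
  have hA : 0 ≤ ∑ k ∈ Finset.Icc 2 j, (groupCard μ k : ℝ) := by positivity
  have hC : ∑ k ∈ Finset.Icc (j + 1) (numGroups μ), (groupCard μ k : ℝ)
        * (max (max (cOne μ ε₀ (j + 1)) ε₀⁻¹) (√2 * (gap μ k)⁻¹)) ^ 2
      ≤ (∑ k ∈ Finset.Icc (j + 1) (numGroups μ), (groupCard μ k : ℝ))
        * capCoeff μ ε₀ i j ^ 2 := by
    rw [Finset.sum_mul]
    refine Finset.sum_le_sum fun k hk => mul_le_mul_of_nonneg_left ?_ (by positivity)
    obtain ⟨k1, k2⟩ := Finset.mem_Icc.1 hk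
    exact pow_le_pow_left₀ (h0.trans (le_max_left _ _))
      (max_le h1 ((gap_inv_le hj k1 k2).trans hM1)) 2
  have e1 := mul_le_mul_of_nonneg_left sq1 (Nat.cast_nonneg (α := ℝ) (numBest μ))
  have e2 := mul_le_mul_of_nonneg_left sq2
    (add_nonneg (Nat.cast_nonneg (α := ℝ) (numBest μ)) hA)
  have e3 := mul_le_mul_of_nonneg_right sq3 hA
  unfold hTilde
  rw [hsum1, ← hsplit]
  simp only [div_eq_mul_inv _ (_ ^ 2), ← inv_pow]
  nlinarith [e1, e2, e3, hC]

/-- The only property of the complexity which the analysis of the algorithm uses. -/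
lemma exists_base_le_complexity [Nonempty (Fin K)] {i : ℕ} (hε₀ : 0 < ε₀) (h1 : 1 ≤ i)
    (hi : i < numGroups μ) :
    ∃ j, 1 ≤ j ∧ j ≤ i ∧ (K : ℝ) * baseCoeff μ ε₀ i j ^ 2 ≤ complexity μ ε₀ i := by
  have : Nonempty (Finset.Icc 1 i) := ⟨⟨1, Finset.mem_Icc.2 ⟨le_rfl, h1⟩⟩⟩
  rcases min_choice (detailedComplexity μ ε₀ i) (simpleComplexity μ ε₀ i) with h | h
  · obtain ⟨⟨j, hj⟩, e⟩ := exists_eq_ciInf_of_finite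
      (f := fun j : Finset.Icc 1 i => max (hBar μ ε₀ i j) (hTilde μ ε₀ i j))
    obtain ⟨j1, j2⟩ := Finset.mem_Icc.1 hj
    refine ⟨j, j1, j2, ?_⟩
    rw [complexity, h, detailedComplexity, ← e]
    exact (base_le_hBar hε₀ j1 j2 hi).trans (le_max_left _ _)
  · obtain ⟨⟨j, hj⟩, e⟩ := exists_eq_ciInf_of_finite
      (f := fun j : Finset.Icc 1 i => capCoeff μ ε₀ i j ^ 2)
    obtain ⟨j1, j2⟩ := Finset.mem_Icc.1 hj
    refine ⟨j, j1, j2, ?_⟩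
    rw [complexity, h]
    refine le_of_le_of_eq ?_ (congrArg ((K : ℝ) * ·) e)
    exact mul_le_mul_of_nonneg_left (pow_le_pow_left₀ (baseCoeff_pos hε₀ j1 j2 hi).le
      (baseCoeff_le_capCoeff j1 j2 hi) 2) (by positivity)

lemma detailedComplexity_nonneg [Nonempty (Fin K)] {i : ℕ} (hε₀ : 0 < ε₀)
    (hi : i < numGroups μ) : 0 ≤ detailedComplexity μ ε₀ i := by
  refine Real.iInf_nonneg fun ⟨j, hj⟩ => ?_
  obtain ⟨j1, j2⟩ := Finset.mem_Icc.1 hj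
  refine le_trans ?_ ((base_le_hBar hε₀ j1 j2 hi).trans (le_max_left _ _))
  positivity

/-- For `i = 1` the only index is `j = 1`, and `baseCoeff` and `capCoeff` coincide. -/
lemma complexity_one [Nonempty (Fin K)] (hε₀ : 0 < ε₀) (h : 2 ≤ numGroups μ) :
    complexity μ ε₀ 1 = (K : ℝ) * (2 * (gap μ 2)⁻¹ + 3 * ε₀⁻¹) ^ 2 ∧
    detailedComplexity μ ε₀ 1 = (K : ℝ) * (2 * (gap μ 2)⁻¹ + 3 * ε₀⁻¹) ^ 2 := by
  have hε : 0 < ε₀⁻¹ := by positivity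
  have hg : 0 < (gap μ 2)⁻¹ := inv_pos.2 (gap_pos le_rfl h)
  have hc : cTwo μ ε₀ (1 + 1) 1 = 2 * (gap μ 2)⁻¹ + 3 * ε₀⁻¹ := by
    simp [cTwo, gap_one]
  have hcap : capCoeff μ ε₀ 1 1 = 2 * (gap μ 2)⁻¹ + 3 * ε₀⁻¹ := by
    unfold capCoeff; rw [hc]; exact max_eq_right (by norm_num; linarith)
  have hbase : baseCoeff μ ε₀ 1 1 = 2 * (gap μ 2)⁻¹ + 3 * ε₀⁻¹ := by
    unfold baseCoeff; rw [hc]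
    refine max_eq_right ?_
    have := mul_le_mul_of_nonneg_right sqrt_two_le hg.le
    norm_num
    linarith
  have h1 := base_le_hBar (μ := μ) hε₀ (i := 1) le_rfl le_rfl h
  have h2 := hBar_le_cap (μ := μ) hε₀ (i := 1) le_rfl le_rfl h
  have h3 := hTilde_le_cap (μ := μ) hε₀ (i := 1) le_rfl le_rfl h
  rw [hbase] at h1
  rw [hcap] at h2 h3
  simp only [Finset.Icc_eq_empty (show ¬ 2 ≤ 1 by norm_num), Finset.sum_empty, zero_div,
    add_zero] at h3
  have hd : detailedComplexity μ ε₀ 1 = (K : ℝ) * (2 * (gap μ 2)⁻¹ + 3 * ε₀⁻¹) ^ 2 := by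
    have : Unique (Finset.Icc 1 1) :=
      ⟨⟨⟨1, by simp⟩⟩, fun ⟨a, ha⟩ => Subtype.ext (by simpa using ha)⟩
    have hdef : ((default : Finset.Icc 1 1) : ℕ) = 1 := by
      simpa using (default : Finset.Icc 1 1).2
    unfold detailedComplexity
    rw [ciInf_unique, hdef, le_antisymm h2 h1, max_eq_left h3]
  have hs : simpleComplexity μ ε₀ 1 = (K : ℝ) * (2 * (gap μ 2)⁻¹ + 3 * ε₀⁻¹) ^ 2 := by
    have : Unique (Finset.Icc 1 1) :=
      ⟨⟨⟨1, by simp⟩⟩, fun ⟨a, ha⟩ => Subtype.ext (by simpa using ha)⟩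
    have hdef : ((default : Finset.Icc 1 1) : ℕ) = 1 := by
      simpa using (default : Finset.Icc 1 1).2
    unfold simpleComplexity
    rw [ciInf_unique, hdef]
    exact congrArg (fun x => (K : ℝ) * x ^ 2) hcap
  exact ⟨by rw [complexity, hd, hs, min_self], hd⟩

lemma gap_inv_le_complexity [Nonempty (Fin K)] {i : ℕ} (hε₀ : 0 < ε₀) (h1 : 1 ≤ i)
    (hi : i < numGroups μ) : (K : ℝ) * ((gap μ (i + 1))⁻¹) ^ 2 ≤ complexity μ ε₀ i := by
  obtain ⟨j, j1, j2, h⟩ := exists_base_le_complexity hε₀ h1 hi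
  refine le_trans (mul_le_mul_of_nonneg_left (pow_le_pow_left₀ ?_ ?_ 2) (by positivity)) h
  · exact inv_nonneg.2 (gap_nonneg (by omega) hi)
  · have hd := sub_pos.2 (gap_lt_gap (μ := μ) j1 (Nat.lt_succ_of_le j2) hi)
    have hle : (gap μ (i + 1))⁻¹ ≤ (gap μ (i + 1) - gap μ j)⁻¹ :=
      inv_anti₀ hd (by linarith [gap_nonneg (μ := μ) j1 (j2.trans hi.le)])
    have := two_inv_le_cTwo (μ := μ) hε₀ j1 (Nat.lt_succ_of_le j2) hi
    have h0 := inv_pos.2 hd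
    refine le_trans ?_ (le_max_right _ _)
    linarith

lemma detailedComplexity_le [Nonempty (Fin K)] {i : ℕ} (hε₀ : 0 < ε₀) (h1 : 1 ≤ i)
    (hi : i < numGroups μ) :
    detailedComplexity μ ε₀ i ≤ 3 / 2 * complexity μ ε₀ i := by
  have : Nonempty (Finset.Icc 1 i) := ⟨⟨1, Finset.mem_Icc.2 ⟨le_rfl, h1⟩⟩⟩
  have hd := detailedComplexity_nonneg (μ := μ) hε₀ hi
  rw [complexity, mul_min_of_nonneg _ _ (by norm_num)]
  refine le_min (by linarith) ?_
  obtain ⟨⟨j, hj⟩, e⟩ := exists_eq_ciInf_of_finite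
    (f := fun j : Finset.Icc 1 i => capCoeff μ ε₀ i j ^ 2)
  have hs : simpleComplexity μ ε₀ i = K * capCoeff μ ε₀ i j ^ 2 :=
    congrArg ((K : ℝ) * ·) e.symm
  obtain ⟨j1, j2⟩ := Finset.mem_Icc.1 hj
  rw [hs]
  refine (ciInf_le (Set.finite_range _).bddBelow ⟨j, hj⟩).trans (max_le ?_ ?_)
  · refine (hBar_le_cap hε₀ j1 j2 hi).trans ?_
    have : 0 ≤ (K : ℝ) * capCoeff μ ε₀ i j ^ 2 := by positivity
    linarith
  · refine (hTilde_le_cap hε₀ j1 j2 hi).trans ?_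
    rw [← mul_assoc]
    refine mul_le_mul_of_nonneg_right ?_ (by positivity)
    have hsplit := groupCard_split (μ := μ) j1 (j2.trans hi.le) le_rfl
    have hB : 0 ≤ ∑ k ∈ Finset.Icc (j + 1) (numGroups μ), (groupCard μ k : ℝ) := by positivity
    have hC : 0 ≤ ∑ k ∈ Finset.Icc (numGroups μ + 1) (numGroups μ), (groupCard μ k : ℝ) := by
      positivity
    have : (0 : ℝ) ≤ numBest μ := by positivity
    linarith

end Complexity

/-! ### Counting the rounds in which an arm is leader or challenger -/

section Tracking

variable {K : ℕ} {ε₀ : ℝ} {arm lead chal : ℕ → Fin K} {rew : ℕ → ℝ}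

lemma pulls_mono (arm : ℕ → Fin K) (a : Fin K) {s t : ℕ} (h : s ≤ t) :
    pulls arm s a ≤ pulls arm t a :=
  Finset.card_le_card (Finset.filter_subset_filter _ (Finset.Ico_subset_Ico_right h))

lemma pulls_succ (arm : ℕ → Fin K) (a : Fin K) {t : ℕ} (ht : 1 ≤ t) :
    pulls arm (t + 1) a = pulls arm t a + if arm t = a then 1 else 0 := by
  unfold pulls
  simp only [Finset.card_filter]
  exact Finset.sum_Ico_succ_top ht _

lemma pulls_lt (arm : ℕ → Fin K) (a : Fin K) {t : ℕ} (ht : 1 ≤ t) : pulls arm t a < t := by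
  have := (Finset.card_filter_le (Finset.Ico 1 t) fun s => arm s = a)
  rw [Nat.card_Ico] at this
  unfold pulls
  omega

lemma Follows.pulls_pos {β : ℝ} (h : Follows ε₀ β arm rew lead chal) {t : ℕ} (ht : K < t)
    (a : Fin K) : 1 ≤ pulls arm t a :=
  (h.init a).symm.le.trans (pulls_mono arm a ht)

/-- With proportions `1 / 2`, a pair which was selected `m` times had its challenger pulled
`c` times with `m ≤ 2 c ≤ m + 2`. -/
lemma Follows.chalPulls_bounds (h : Follows ε₀ (1 / 2) arm rew lead chal) {i j : Fin K}
    (hij : i ≠ j) (n : ℕ) :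
    pairCount lead chal n i j ≤ 2 * chalPulls arm lead chal n i j ∧
      2 * chalPulls arm lead chal n i j ≤ pairCount lead chal n i j + 2 := by
  induction n with
  | zero => simp [pairCount, chalPulls]
  | succ n ih =>
    by_cases hn : K < n
    · have e1 : pairCount lead chal (n + 1) i j = pairCount lead chal n i j
          + if lead n = i ∧ chal n = j then 1 else 0 := by
        simp only [pairCount, Finset.card_filter]
        exact Finset.sum_Ico_succ_top hn _
      have e2 : chalPulls arm lead chal (n + 1) i j = chalPulls arm lead chal n i j
          + if (lead n = i ∧ chal n = j) ∧ arm n = j then 1 else 0 := by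
        simp only [chalPulls, Finset.card_filter]
        exact Finset.sum_Ico_succ_top hn _
      by_cases hp : lead n = i ∧ chal n = j
      · have ht := h.track n hn
        rw [hp.1, hp.2, e1, if_pos hp] at ht
        rw [e1, e2, if_pos hp]
        split_ifs at ht with hc
        · rw [if_pos ⟨hp, ht⟩]
          have hc' : (2 * chalPulls arm lead chal n i j : ℝ)
              ≤ pairCount lead chal n i j + 1 := by
            push_cast at hc; linarith
          have : 2 * chalPulls arm lead chal n i j ≤ pairCount lead chal n i j + 1 := by
            exact_mod_cast hc'
          omega
        · rw [if_neg fun h' => hij (ht.symm.trans h'.2)]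
          have hc' : (pairCount lead chal n i j + 1 : ℝ)
              < 2 * chalPulls arm lead chal n i j := by
            push_cast at hc; linarith
          have : pairCount lead chal n i j + 1 < 2 * chalPulls arm lead chal n i j := by
            exact_mod_cast hc'
          omega
      · rw [e1, e2, if_neg hp, if_neg fun h' => hp h'.1]
        exact ih
    · have : Finset.Ico (K + 1) (n + 1) = ∅ := Finset.Ico_eq_empty (by omega)
      simp [pairCount, chalPulls, this]

/-- An arm which was leader or challenger in `T` rounds was pulled at least `T / 2 - (K - 1)`
times: each of the `K - 1` pairs in which it leads costs at most one pull. -/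
lemma Follows.card_active_le (h : Follows ε₀ (1 / 2) arm rew lead chal) (a : Fin K) (n : ℕ) :
    ((Finset.Ico (K + 1) n).filter fun t => lead t = a ∨ chal t = a).card
      ≤ 2 * pulls arm n a + 2 * (K - 1) := by
  set R := Finset.Ico (K + 1) n
  have hne : ∀ t ∈ R, chal t ≠ lead t := fun t ht =>
    h.chal_ne t (by have := (Finset.mem_Ico.1 ht).1; omega)
  -- the number of active rounds, split over the other member of the pair
  have e1 : (R.filter fun t => lead t = a ∨ chal t = a).card
      = ∑ j ∈ Finset.univ.erase a,
        (pairCount lead chal n a j + pairCount lead chal n j a) := by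
    simp only [pairCount, Finset.card_filter, ← Finset.sum_add_distrib]
    rw [Finset.sum_comm]
    refine Finset.sum_congr rfl fun t ht => ?_
    have hn := hne t ht
    by_cases h1 : lead t = a
    · have h2 : chal t ≠ a := fun h' => hn (h'.trans h1.symm)
      rw [Finset.sum_eq_single_of_mem (chal t) (by simp [h2])]
      · simp [h1, h2]
      · intro j _ hj
        simp [h2, hj.symm]
    · by_cases h2 : chal t = a
      · rw [Finset.sum_eq_single_of_mem (lead t) (by simp [h1])]
        · simp [h1, h2]
        · intro j _ hj
          simp [h1, hj.symm]
      · simp [h1, h2]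
  have e2 : ∑ j ∈ Finset.univ.erase a, (pairCount lead chal n a j
        + chalPulls arm lead chal n j a)
      ≤ pulls arm n a + ∑ j ∈ Finset.univ.erase a, chalPulls arm lead chal n a j := by
    have hp : (R.filter fun t => arm t = a).card ≤ pulls arm n a :=
      Finset.card_le_card (Finset.filter_subset_filter _
        (Finset.Ico_subset_Ico_left (by omega)))
    refine le_trans ?_ (Nat.add_le_add_right hp _)
    simp only [pairCount, chalPulls, Finset.card_filter, ← Finset.sum_add_distrib]
    rw [Finset.sum_comm, Finset.sum_comm (s := Finset.univ.erase a), ← Finset.sum_add_distrib]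
    refine Finset.sum_le_sum fun t ht => ?_
    have hn := hne t ht
    have ht' := h.track t (by have := (Finset.mem_Ico.1 ht).1; omega)
    have harm : arm t = chal t ∨ arm t = lead t := by
      split_ifs at ht' <;> simp [ht']
    by_cases h1 : lead t = a
    · have h2 : chal t ≠ a := fun h' => hn (h'.trans h1.symm)
      rw [Finset.sum_eq_single_of_mem (chal t) (by simp [h2]),
        Finset.sum_eq_single_of_mem (chal t) (by simp [h2])]
      · rcases harm with h3 | h3 <;> simp [h1, h2, h3]
      · intro j _ hj
        simp [hj.symm]
      · intro j _ hj
        simp [h2, hj.symm]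
    · by_cases h2 : chal t = a
      · rw [Finset.sum_eq_single_of_mem (lead t) (by simp [h1])]
        · simp [h1, h2]
        · intro j _ hj
          simp [h1, hj.symm]
      · simp [h1, h2]
  have hcard : (Finset.univ.erase a : Finset (Fin K)).card = K - 1 := by simp
  have e3 : ∑ j ∈ Finset.univ.erase a, 2 * chalPulls arm lead chal n a j
      ≤ ∑ j ∈ Finset.univ.erase a, (pairCount lead chal n a j + 2) :=
    Finset.sum_le_sum fun j hj =>
      (h.chalPulls_bounds (Finset.ne_of_mem_erase hj).symm n).2
  have e4 : ∑ j ∈ Finset.univ.erase a, pairCount lead chal n j a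
      ≤ ∑ j ∈ Finset.univ.erase a, 2 * chalPulls arm lead chal n j a :=
    Finset.sum_le_sum fun j hj => (h.chalPulls_bounds (Finset.ne_of_mem_erase hj) n).1
  rw [e1]
  simp only [Finset.sum_add_distrib, ← Finset.mul_sum, Finset.sum_const, hcard,
    smul_eq_mul] at e2 e3 e4 ⊢
  omega

/-- If in every round `K < t < n` the leader or the challenger was pulled at most `D` times so far,
then the horizon `n` is at most `2 K D + 2 K ^ 2 + 1`. -/
lemma Follows.horizon_le (h : Follows ε₀ (1 / 2) arm rew lead chal) (hK : 1 ≤ K) {D : ℝ}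
    (hD : 0 ≤ D) {n : ℕ}
    (hn : ∀ t, K < t → t < n →
      (pulls arm t (lead t) : ℝ) ≤ D ∨ (pulls arm t (chal t) : ℝ) ≤ D) :
    (n : ℝ) ≤ 2 * K * D + 2 * K ^ 2 + 1 := by
  classical
  set R := Finset.Ico (K + 1) n
  let A : Fin K → Finset ℕ := fun a =>
    R.filter fun t => (lead t = a ∨ chal t = a) ∧ (pulls arm t a : ℝ) ≤ D
  have hA : ∀ a, ((A a).card : ℝ) ≤ 2 * D + (2 * K - 1) := by
    intro a
    have hK' : (1 : ℝ) ≤ K := by exact_mod_cast hK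
    rcases (A a).eq_empty_or_nonempty with he | hne
    · rw [he]; simp only [Finset.card_empty, Nat.cast_zero]; linarith
    · set t := (A a).max' hne
      have ht := (A a).max'_mem hne
      obtain ⟨-, -, htD⟩ := Finset.mem_filter.1 ht
      have hsub : A a ⊆
          insert t ((Finset.Ico (K + 1) t).filter fun s => lead s = a ∨ chal s = a) := by
        intro s hs
        obtain ⟨hsR, hs1, -⟩ := Finset.mem_filter.1 hs
        rcases ((A a).le_max' s hs).eq_or_lt with e | hlt
        · exact Finset.mem_insert.2 (Or.inl e)
        · exact Finset.mem_insert_of_mem (Finset.mem_filter.2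
            ⟨Finset.mem_Ico.2 ⟨(Finset.mem_Ico.1 hsR).1, hlt⟩, hs1⟩)
      have hc := (Finset.card_le_card hsub).trans ((Finset.card_insert_le _ _).trans
        (Nat.add_le_add_right (h.card_active_le a t) 1))
      have hc' : ((A a).card : ℝ) ≤ 2 * pulls arm t a + 2 * (K - 1) + 1 := by
        have := (Nat.cast_le (α := ℝ)).2 hc
        push_cast [Nat.cast_sub hK] at this
        exact this
      linarith
  have hR : R ⊆ Finset.univ.biUnion A := by
    intro t ht
    obtain ⟨h1, h2⟩ := Finset.mem_Ico.1 ht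
    rcases hn t h1 h2 with h' | h'
    · exact Finset.mem_biUnion.2
        ⟨lead t, Finset.mem_univ _, Finset.mem_filter.2 ⟨ht, Or.inl rfl, h'⟩⟩
    · exact Finset.mem_biUnion.2
        ⟨chal t, Finset.mem_univ _, Finset.mem_filter.2 ⟨ht, Or.inr rfl, h'⟩⟩
  have hcard := (Finset.card_le_card hR).trans Finset.card_biUnion_le
  rw [Nat.card_Ico] at hcard
  have h1 : (n : ℝ) ≤ (∑ a, (A a).card : ℕ) + (K + 1) := by
    have : n ≤ (∑ a, (A a).card) + (K + 1) := by omega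
    exact_mod_cast this
  have h2 : ((∑ a, (A a).card : ℕ) : ℝ) ≤ K * (2 * D + (2 * K - 1)) := by
    push_cast
    refine (Finset.sum_le_sum fun a _ => hA a).trans (le_of_eq ?_)
    rw [Finset.sum_const, Finset.card_univ, Fintype.card_fin, nsmul_eq_mul]
  nlinarith

end Tracking

/-! ### What a wrong recommendation says about the sampling -/

section Deterministic

variable {K : ℕ} {μ : Fin K → ℝ} {ε₀ β x : ℝ} {arm lead chal : ℕ → Fin K} {rew : ℕ → ℝ}

/-- The sum of the centred rewards of arm `a` before round `n`. -/
def devSum (μ : Fin K → ℝ) (arm : ℕ → Fin K) (rew : ℕ → ℝ) (n : ℕ) (a : Fin K) : ℝ :=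
  ∑ t ∈ (Finset.Ico 1 n).filter (fun t => arm t = a), (rew t - μ a)

lemma empMean_eq {n : ℕ} {a : Fin K} (h : 1 ≤ pulls arm n a) :
    empMean arm rew n a = μ a + devSum μ arm rew n a / pulls arm n a := by
  have h' : (pulls arm n a : ℝ) ≠ 0 := by positivity
  unfold empMean devSum
  rw [Finset.sum_sub_distrib, Finset.sum_const, nsmul_eq_mul]
  change _ = μ a + (_ - (pulls arm n a : ℝ) * μ a) / _
  field_simp
  ring

/-- The deviations of the empirical means are jointly controlled at time `t`, at level `x`, for all
pairs of arms. -/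
def Concentrated (μ : Fin K → ℝ) (x : ℝ) (arm : ℕ → Fin K) (rew : ℕ → ℝ) (t : ℕ) : Prop :=
  ∀ a b, a ≠ b → devSum μ arm rew t a ^ 2 / pulls arm t a
    + devSum μ arm rew t b ^ 2 / pulls arm t b < 3 * x

lemma Concentrated.abs_sub_le (h : Concentrated μ x arm rew t) {a b : Fin K}
    (hab : a ≠ b) (ha : 1 ≤ pulls arm t a) (hb : 1 ≤ pulls arm t b) :
    |(empMean arm rew t a - empMean arm rew t b) - (μ a - μ b)|
      ≤ √(3 * x) * √(1 / (pulls arm t a : ℝ) + 1 / (pulls arm t b : ℝ)) := by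
  have hx := h a b hab
  rw [empMean_eq (μ := μ) ha, empMean_eq (μ := μ) hb]
  have ha' : (0 : ℝ) < pulls arm t a := by exact_mod_cast ha
  have hb' : (0 : ℝ) < pulls arm t b := by exact_mod_cast hb
  generalize devSum μ arm rew t a = u at *
  generalize devSum μ arm rew t b = v at *
  generalize (pulls arm t a : ℝ) = p at *
  generalize (pulls arm t b : ℝ) = q at *
  have hx0 : 0 ≤ 3 * x := le_trans (by positivity) hx.le
  rw [← Real.sqrt_mul hx0]
  refine Real.abs_le_sqrt ?_
  -- the Cauchy–Schwarz inequality
  have cs : (u / p - v / q) ^ 2 ≤ (u ^ 2 / p + v ^ 2 / q) * (1 / p + 1 / q) := by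
    have e : (u ^ 2 / p + v ^ 2 / q) * (1 / p + 1 / q) - (u / p - v / q) ^ 2
        = (u + v) ^ 2 / (p * q) := by
      field_simp; ring
    have : 0 ≤ (u + v) ^ 2 / (p * q) := by positivity
    linarith
  calc _ = (u / p - v / q) ^ 2 := by ring
    _ ≤ _ := cs
    _ ≤ _ := mul_le_mul_of_nonneg_right hx.le (by positivity)

/-- If an arm `k` is empirically at least as good as an arm `a`, the mean of `a` cannot exceed that
of `k` by much. -/
lemma Concentrated.sub_le_of_le (h : Concentrated μ x arm rew t) {a k : Fin K}
    (hak : a ≠ k) (ha : 1 ≤ pulls arm t a) (hk : 1 ≤ pulls arm t k)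
    (hle : empMean arm rew t a ≤ empMean arm rew t k) :
    μ a - μ k ≤ √(3 * x) * √(1 / (pulls arm t k : ℝ) + 1 / (pulls arm t a : ℝ)) := by
  have := (abs_le.1 (h.abs_sub_le hak.symm hk ha)).2
  linarith

/-- When both the leader and the challenger have been pulled more than `4 x m ^ 2` times, their
transportation cost is large because of the slack `ε₀`, hence so is the cost of any other arm. -/
lemma Follows.lt_cost (hf : Follows ε₀ β arm rew lead chal) (hε₀ : 0 < ε₀) (hx : 0 < x)
    {m : ℝ} (hm : 0 < m) {t : ℕ} (ht : K < t) (h : Concentrated μ x arm rew t)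
    (hB : 4 * x * m ^ 2 < pulls arm t (lead t)) (hC : 4 * x * m ^ 2 < pulls arm t (chal t))
    {u : Fin K} (hu : u ≠ lead t) :
    ε₀ * (√(2 * x) * m) < (μ (lead t) - μ u + ε₀)
        / √(1 / (pulls arm t (lead t) : ℝ) + 1 / (pulls arm t u : ℝ)) + √(3 * x) := by
  have hpos : ∀ a, (0 : ℝ) < pulls arm t a := fun a => by exact_mod_cast hf.pulls_pos ht a
  have hmin := hf.chal_min t ht u hu
  have hCB := hf.lead_best t ht (chal t)
  have hD : 0 < 4 * x * m ^ 2 := by positivity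
  have hwC : 0 < √(1 / (pulls arm t (lead t) : ℝ) + 1 / (pulls arm t (chal t) : ℝ)) :=
    Real.sqrt_pos.2 (by have := hpos (lead t); have := hpos (chal t); positivity)
  have hwU : 0 < √(1 / (pulls arm t (lead t) : ℝ) + 1 / (pulls arm t u : ℝ)) :=
    Real.sqrt_pos.2 (by have := hpos (lead t); have := hpos u; positivity)
  have hw : √(1 / (pulls arm t (lead t) : ℝ) + 1 / (pulls arm t (chal t) : ℝ))
      < 1 / (√(2 * x) * m) := by
    have h1 := one_div_lt_one_div_of_lt hD hB
    have h2 := one_div_lt_one_div_of_lt hD hC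
    have hs : 0 < √(2 * x) := Real.sqrt_pos.2 (by positivity)
    rw [Real.sqrt_lt' (by positivity), div_pow, mul_pow, Real.sq_sqrt (by positivity)]
    calc _ < 1 / (4 * x * m ^ 2) + 1 / (4 * x * m ^ 2) := add_lt_add h1 h2
      _ = _ := by field_simp; ring
  have hs : 0 < √(2 * x) * m := mul_pos (Real.sqrt_pos.2 (by positivity)) hm
  calc ε₀ * (√(2 * x) * m)
      < ε₀ / √(1 / (pulls arm t (lead t) : ℝ) + 1 / (pulls arm t (chal t) : ℝ)) := by
        rw [lt_div_iff₀ hwC, mul_assoc]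
        rw [lt_div_iff₀ hs] at hw
        nlinarith
    _ ≤ transportCost ε₀ arm rew t (lead t) (chal t) := by
        unfold transportCost
        gcongr
        linarith
    _ ≤ transportCost ε₀ arm rew t (lead t) u := hmin
    _ ≤ _ := by
        unfold transportCost
        rw [div_add' _ _ _ hwU.ne']
        have := (abs_le.1 (h.abs_sub_le hu.symm (hf.pulls_pos ht _) (hf.pulls_pos ht u))).2
        refine div_le_div_of_nonneg_right ?_ hwU.le
        linarith

/-- If a bad arm `k` that is wrongly recommended later is undersampled, then so is the leader or
the challenger. -/
lemma Follows.undersampled_of_bad_arm [Nonempty (Fin K)] (hf : Follows ε₀ β arm rew lead chal)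
    (hε₀ : 0 < ε₀) (hx : 0 < x) {i j : ℕ} (hj : 1 ≤ j) (hji : j ≤ i) (hi : i < numGroups μ)
    {t : ℕ} (ht : K < t) (h : Concentrated μ x arm rew t) {k : Fin K}
    (hk : gap μ (i + 1) ≤ bestMean μ - μ k)
    (hN : (pulls arm t k : ℝ) ≤ 6 * x / (bestMean μ - μ k - gap μ j) ^ 2) :
    (pulls arm t (lead t) : ℝ) ≤ 4 * x * baseCoeff μ ε₀ i j ^ 2 ∨
      (pulls arm t (chal t) : ℝ) ≤ 4 * x * baseCoeff μ ε₀ i j ^ 2 := by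
  by_contra! hcon
  obtain ⟨hB, hC⟩ := hcon
  have hm := baseCoeff_pos (μ := μ) hε₀ hj hji hi
  have hgj := gap_nonneg (μ := μ) hj (hji.trans hi.le)
  have hd : 0 < gap μ (i + 1) - gap μ j :=
    sub_pos.2 (gap_lt_gap hj (Nat.lt_succ_of_le hji) hi)
  set δ := bestMean μ - μ k
  have hδ : gap μ (i + 1) - gap μ j ≤ δ - gap μ j := by linarith
  have hδ0 : 0 < δ - gap μ j := hd.trans_le hδ
  have hcm : cTwo μ ε₀ (i + 1) j ≤ baseCoeff μ ε₀ i j := le_max_right _ _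
  have h2 := two_inv_le_cTwo (μ := μ) hε₀ hj (Nat.lt_succ_of_le hji) hi
  have hsmall : 6 * x / (δ - gap μ j) ^ 2 ≤ 4 * x * baseCoeff μ ε₀ i j ^ 2 := by
    have h3 : (δ - gap μ j)⁻¹ ≤ (gap μ (i + 1) - gap μ j)⁻¹ := inv_anti₀ hd hδ
    have h4 : 2 * (δ - gap μ j)⁻¹ ≤ baseCoeff μ ε₀ i j := by linarith
    have h5 := pow_le_pow_left₀ (by positivity) h4 2
    have h6 := mul_le_mul_of_nonneg_left h5 hx.le
    have h7 : 0 ≤ x * (δ - gap μ j)⁻¹ ^ 2 := by positivity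
    rw [div_eq_mul_inv, ← inv_pow]
    nlinarith
  have hu : k ≠ lead t := by
    rintro e
    rw [← e] at hB
    linarith
  have key := hf.lt_cost hε₀ hx hm ht h hB hC hu
  have hNk : (0 : ℝ) < pulls arm t k := by exact_mod_cast hf.pulls_pos ht k
  have hNB : (0 : ℝ) < pulls arm t (lead t) := by exact_mod_cast hf.pulls_pos ht _
  have hw : (δ - gap μ j) / √(6 * x)
      ≤ √(1 / (pulls arm t (lead t) : ℝ) + 1 / (pulls arm t k : ℝ)) := by
    refine Real.le_sqrt_of_sq_le ?_
    rw [div_pow, Real.sq_sqrt (by positivity)]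
    have h1 : (δ - gap μ j) ^ 2 / (6 * x) ≤ 1 / (pulls arm t k : ℝ) := by
      rw [le_div_iff₀ (by positivity)] at hN
      rw [div_le_div_iff₀ (by positivity) hNk]
      linarith
    have h2 : 0 < 1 / (pulls arm t (lead t) : ℝ) := by positivity
    linarith
  have hs6 : 0 < √(6 * x) := Real.sqrt_pos.2 (by positivity)
  set q := (gap μ j + ε₀) / (gap μ (i + 1) - gap μ j) with hq
  have hq0 : 0 ≤ q := by positivity
  have hle : (μ (lead t) - μ k + ε₀)
        / √(1 / (pulls arm t (lead t) : ℝ) + 1 / (pulls arm t k : ℝ))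
      ≤ √(6 * x) * (1 + q) := by
    have h1 : μ (lead t) - μ k ≤ δ := by
      have := le_bestMean μ (lead t); simp only [δ]; linarith
    have hδε : 0 ≤ δ + ε₀ := by linarith
    calc _ ≤ (δ + ε₀) / √(1 / (pulls arm t (lead t) : ℝ) + 1 / (pulls arm t k : ℝ)) := by
          gcongr
      _ ≤ (δ + ε₀) / ((δ - gap μ j) / √(6 * x)) := by gcongr
      _ = √(6 * x) * (1 + (gap μ j + ε₀) / (δ - gap μ j)) := by field_simp; ring
      _ ≤ _ := by rw [hq]; gcongr
  have hεm : 2 * q + 3 ≤ ε₀ * baseCoeff μ ε₀ i j := by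
    refine le_trans (le_of_eq ?_) (mul_le_mul_of_nonneg_left hcm hε₀.le)
    unfold cTwo
    rw [hq]
    field_simp
  have hs : 0 < √x := Real.sqrt_pos.2 hx
  rw [Real.sqrt_mul (by norm_num)] at key hle
  rw [Real.sqrt_mul (by norm_num)] at key
  have s2 : (1.414 : ℝ) ≤ √2 := Real.le_sqrt_of_sq_le (by norm_num)
  have s6 : √6 ≤ (2.4495 : ℝ) := by rw [Real.sqrt_le_left (by norm_num)]; norm_num
  have s3 : √3 ≤ (1.7321 : ℝ) := by rw [Real.sqrt_le_left (by norm_num)]; norm_num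
  have key2 : √x * (√2 * (2 * q + 3)) < √x * (√6 * (1 + q) + √3) := by
    have h1 : √x * √2 * (2 * q + 3) ≤ √x * √2 * (ε₀ * baseCoeff μ ε₀ i j) := by gcongr
    nlinarith
  have key3 := lt_of_mul_lt_mul_left key2 hs.le
  -- `√6 + √3 < 3 √2` and `√6 < 2 √2`
  nlinarith

/-- If the leader is not in the groups up to `j`, then it or the challenger is undersampled: the
cost of a best arm is small, because that arm is empirically not better than the leader. -/
lemma Follows.undersampled_of_bad_leader [Nonempty (Fin K)]
    (hf : Follows ε₀ β arm rew lead chal)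
    (hε₀ : 0 < ε₀) (hx : 0 < x) {i j : ℕ} (hj : 1 ≤ j) (hji : j ≤ i) (hi : i < numGroups μ)
    {t : ℕ} (ht : K < t) (h : Concentrated μ x arm rew t)
    (hlead : gap μ (j + 1) ≤ bestMean μ - μ (lead t)) :
    (pulls arm t (lead t) : ℝ) ≤ 4 * x * baseCoeff μ ε₀ i j ^ 2 ∨
      (pulls arm t (chal t) : ℝ) ≤ 4 * x * baseCoeff μ ε₀ i j ^ 2 := by
  by_contra! hcon
  obtain ⟨hB, hC⟩ := hcon
  have hm := baseCoeff_pos (μ := μ) hε₀ hj hji hi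
  have hg : 0 < gap μ (j + 1) := gap_pos (by omega) (by omega)
  obtain ⟨u, hu⟩ := exists_eq_bestMean μ
  set δ := bestMean μ - μ (lead t) with hδ
  have hδ0 : 0 < δ := hg.trans_le hlead
  have hul : u ≠ lead t := by
    rintro e
    rw [hδ, ← e, hu, sub_self] at hδ0
    exact lt_irrefl _ hδ0
  have key := hf.lt_cost hε₀ hx hm ht h hB hC hul
  have hw := h.sub_le_of_le hul (hf.pulls_pos ht u) (hf.pulls_pos ht _)
    (hf.lead_best t ht u)
  rw [hu] at hw key
  set w := √(1 / (pulls arm t (lead t) : ℝ) + 1 / (pulls arm t u : ℝ))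
  have hs3 : 0 < √(3 * x) := Real.sqrt_pos.2 (by positivity)
  have hw0 : 0 < w := by
    by_contra! hc
    have := mul_nonpos_of_nonneg_of_nonpos hs3.le hc
    linarith
  have hm1 : 3 * ε₀⁻¹ ≤ baseCoeff μ ε₀ i j :=
    (three_inv_le_cTwo hε₀ hj (Nat.lt_succ_of_le hji) hi).trans (le_max_right _ _)
  have hm2 : √2 * δ⁻¹ ≤ baseCoeff μ ε₀ i j :=
    le_trans (by gcongr) (le_max_left _ _)
  have s2 : (1.414 : ℝ) ≤ √2 := Real.le_sqrt_of_sq_le (by norm_num)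
  have s3 : √3 ≤ (1.7321 : ℝ) := by rw [Real.sqrt_le_left (by norm_num)]; norm_num
  have hs : 0 < √x := Real.sqrt_pos.2 hx
  have e2 : √(2 * x) = √2 * √x := Real.sqrt_mul (by norm_num) _
  have e3 : √(3 * x) = √3 * √x := Real.sqrt_mul (by norm_num) _
  rcases le_total ε₀ δ with hle | hle
  · have h1 : (μ (lead t) - bestMean μ + ε₀) / w ≤ 0 :=
      div_nonpos_of_nonpos_of_nonneg (by linarith) hw0.le
    have h2 : 3 ≤ ε₀ * baseCoeff μ ε₀ i j := by
      have := mul_le_mul_of_nonneg_left hm1 hε₀.le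
      rwa [mul_left_comm, mul_inv_cancel₀ hε₀.ne', mul_one] at this
    have h3 : √2 * √x * 3 ≤ √2 * √x * (ε₀ * baseCoeff μ ε₀ i j) := by gcongr
    rw [e2, e3] at key
    nlinarith
  · have h1 : (μ (lead t) - bestMean μ + ε₀) / w ≤ (ε₀ - δ) * (√(3 * x) / δ) := by
      have h4 : 1 / w ≤ √(3 * x) / δ := by
        rw [div_le_div_iff₀ hw0 hδ0]; linarith
      have h5 := mul_le_mul_of_nonneg_left h4 (sub_nonneg.2 hle)
      rw [mul_one_div] at h5
      have e : μ (lead t) - bestMean μ + ε₀ = ε₀ - δ := by rw [hδ]; ring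
      rwa [e]
    have h2 : (ε₀ - δ) * (√(3 * x) / δ) + √(3 * x) = ε₀ * (√3 * √x) * δ⁻¹ := by
      rw [e3]; field_simp; ring
    have h3 : ε₀ * (√2 * √x) * (√2 * δ⁻¹) ≤ ε₀ * (√2 * √x) * baseCoeff μ ε₀ i j := by gcongr
    have h6 : √2 * √2 = 2 := Real.mul_self_sqrt (by norm_num)
    have h7 : 0 < ε₀ * √x * δ⁻¹ := by positivity
    rw [e2] at key
    nlinarith

/-- A wrong recommendation at time `n` forces the leader or the challenger to be undersampled at
all earlier rounds. Either the recommended arm is undersampled at time `n`, or all the arms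
of the groups up to `j` are; in the second case only a leader outside these groups could be well
sampled. -/
lemma Follows.undersampled [Nonempty (Fin K)] (hf : Follows ε₀ β arm rew lead chal)
    (hε₀ : 0 < ε₀) (hx : 0 < x) {i j : ℕ} (hj : 1 ≤ j) (hji : j ≤ i) (hi : i < numGroups μ)
    {n : ℕ} (h : ∀ t, K < t → t ≤ n → Concentrated μ x arm rew t)
    (hbad : gap μ i < bestMean μ - μ (lead n)) {t : ℕ} (ht : K < t) (htn : t < n) :
    (pulls arm t (lead t) : ℝ) ≤ 4 * x * baseCoeff μ ε₀ i j ^ 2 ∨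
      (pulls arm t (chal t) : ℝ) ≤ 4 * x * baseCoeff μ ε₀ i j ^ 2 := by
  have hn := ht.trans htn
  set k := lead n with hk
  have hgk := gap_succ_le hbad hi.le
  have hmono : ∀ a, (pulls arm t a : ℝ) ≤ pulls arm n a := fun a => by
    exact_mod_cast pulls_mono arm a htn.le
  have hd : 0 < gap μ (i + 1) - gap μ j :=
    sub_pos.2 (gap_lt_gap hj (Nat.lt_succ_of_le hji) hi)
  have hδ : gap μ (i + 1) - gap μ j ≤ bestMean μ - μ k - gap μ j := by linarith
  by_cases hN : (pulls arm n k : ℝ) ≤ 6 * x / (bestMean μ - μ k - gap μ j) ^ 2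
  · exact hf.undersampled_of_bad_arm hε₀ hx hj hji hi ht (h t ht htn.le) hgk
      ((hmono k).trans hN)
  · by_cases hl : gap μ j < bestMean μ - μ (lead t)
    · exact hf.undersampled_of_bad_leader hε₀ hx hj hji hi ht (h t ht htn.le)
        (gap_succ_le hl (hji.trans hi.le))
    · refine Or.inl ((hmono _).trans ?_)
      push Not at hN hl
      set a := lead t
      set d := bestMean μ - μ k - gap μ j with hd'
      have hd0 : 0 < d := hd.trans_le hδ
      have hak : a ≠ k := by
        rintro e
        rw [e] at hl
        linarith
      have hw := (h n hn le_rfl).sub_le_of_le hak (hf.pulls_pos hn a) (hf.pulls_pos hn k)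
        (hf.lead_best n hn a)
      have hNk : (0 : ℝ) < pulls arm n k := by exact_mod_cast hf.pulls_pos hn k
      have hNa : (0 : ℝ) < pulls arm n a := by exact_mod_cast hf.pulls_pos hn a
      have hw2 : d ^ 2 ≤ 3 * x * (1 / (pulls arm n k : ℝ) + 1 / (pulls arm n a : ℝ)) := by
        rw [← Real.sqrt_mul (by positivity)] at hw
        have : d ≤ √(3 * x * (1 / (pulls arm n k : ℝ) + 1 / (pulls arm n a : ℝ))) := by
          linarith
        rwa [Real.le_sqrt hd0.le (by positivity)] at this
      have hk1 : 1 / (pulls arm n k : ℝ) < d ^ 2 / (6 * x) := by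
        rw [div_lt_iff₀ (by positivity)] at hN
        rw [div_lt_div_iff₀ hNk (by positivity)]
        linarith
      have hk2 : d ^ 2 / (6 * x) ≤ 1 / (pulls arm n a : ℝ) := by
        have h1 : 3 * x * (1 / (pulls arm n k : ℝ)) < 3 * x * (d ^ 2 / (6 * x)) := by gcongr
        have h2 : 3 * x * (d ^ 2 / (6 * x)) = d ^ 2 / 2 := by field_simp; ring
        rw [div_le_iff₀ (by positivity)]
        nlinarith
      have hk3 : (pulls arm n a : ℝ) ≤ 6 * x / d ^ 2 := by
        rw [div_le_div_iff₀ (by positivity) hNa] at hk2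
        rw [le_div_iff₀ (by positivity)]
        linarith
      have h3 : d⁻¹ ≤ (gap μ (i + 1) - gap μ j)⁻¹ := inv_anti₀ hd hδ
      have h2 := two_inv_le_cTwo (μ := μ) hε₀ hj (Nat.lt_succ_of_le hji) hi
      have h4 : 2 * d⁻¹ ≤ baseCoeff μ ε₀ i j :=
        le_trans (by linarith) (le_max_right _ _)
      have h6 := mul_le_mul_of_nonneg_left (pow_le_pow_left₀ (by positivity) h4 2) hx.le
      have h7 : 0 ≤ x * d⁻¹ ^ 2 := by positivity
      refine hk3.trans ?_
      rw [div_eq_mul_inv, ← inv_pow]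
      nlinarith

/-- On the concentration event a wrong recommendation occurs only before the horizon given by the
complexity. -/
lemma Follows.lt_of_bad [Nonempty (Fin K)] (hf : Follows ε₀ (1 / 2) arm rew lead chal)
    (hK : 2 ≤ K) (hε₀ : 0 < ε₀) (hx : 0 < x) {i : ℕ} (h1 : 1 ≤ i) (hi : i < numGroups μ)
    {n : ℕ} (h : ∀ t, K < t → t ≤ n → Concentrated μ x arm rew t)
    (hbad : gap μ i < bestMean μ - μ (lead n)) :
    (n : ℝ) < 8 * complexity μ ε₀ i * x + 5 * K ^ 2 / 2 := by
  obtain ⟨j, j1, j2, hc⟩ := exists_base_le_complexity (μ := μ) hε₀ h1 hi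
  have hn := hf.horizon_le (by omega) (D := 4 * x * baseCoeff μ ε₀ i j ^ 2) (by positivity)
    fun t ht htn => hf.undersampled hε₀ hx j1 j2 hi h hbad ht htn
  have hcx := mul_le_mul_of_nonneg_right hc hx.le
  have hK' : (2 : ℝ) ≤ K := by exact_mod_cast hK
  nlinarith

end Deterministic

/-! ### Gaussian mixtures -/

section Mixture

open scoped NNReal ENNReal

lemma lintegral_exp_mul_gaussianReal (v : ℝ≥0) (s : ℝ) :
    ∫⁻ l, ENNReal.ofReal (Real.exp (l * s)) ∂(gaussianReal 0 v)
      = ENNReal.ofReal (Real.exp (v * s ^ 2 / 2)) := by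
  have hi : Integrable (fun l : ℝ => Real.exp (l * s)) (gaussianReal 0 v) := by
    simpa only [mul_comm] using integrable_exp_mul_gaussianReal (μ := 0) (v := v) s
  rw [← ofReal_integral_eq_lintegral_ofReal hi (ae_of_all _ fun _ => (Real.exp_pos _).le)]
  have h := congrFun (mgf_id_gaussianReal (μ := 0) (v := v)) s
  simp only [mgf, id, zero_mul, zero_add] at h
  rw [← h]
  simp only [mul_comm s]

/-- The factor `exp (l ^ 2 / 2)` changes the variance `1 / (h + 1)` into `1 / h`. -/
lemma lintegral_exp_tilt {h : ℝ≥0} (hh : 0 < h) (s : ℝ) :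
    ∫⁻ l, ENNReal.ofReal (Real.exp (l * s + l ^ 2 / 2)) ∂(gaussianReal 0 (h + 1)⁻¹)
      = ENNReal.ofReal (√((h + 1) / h) * Real.exp (s ^ 2 / (2 * h))) := by
  have hpdf : ∀ l : ℝ, gaussianPDFReal 0 (h + 1)⁻¹ l * Real.exp (l * s + l ^ 2 / 2)
      = √((h + 1) / h) * (gaussianPDFReal 0 h⁻¹ l * Real.exp (l * s)) := by
    intro l
    have hh' : (0 : ℝ) < h := by exact_mod_cast hh
    simp only [gaussianPDFReal, NNReal.coe_inv, NNReal.coe_add, NNReal.coe_one, sub_zero]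
    have e1 : (√(2 * Real.pi * ((h : ℝ) + 1)⁻¹))⁻¹
        = √((h + 1) / h) * (√(2 * Real.pi * (h : ℝ)⁻¹))⁻¹ := by
      rw [← Real.sqrt_inv, ← Real.sqrt_inv, ← Real.sqrt_mul (by positivity)]
      congr 1
      field_simp
    have e2 : Real.exp (-l ^ 2 / (2 * ((h : ℝ) + 1)⁻¹)) * Real.exp (l * s + l ^ 2 / 2)
        = Real.exp (-l ^ 2 / (2 * (h : ℝ)⁻¹)) * Real.exp (l * s) := by
      rw [← Real.exp_add, ← Real.exp_add]
      congr 1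
      field_simp
      ring
    rw [e1, mul_assoc, e2]
    ring
  have hm : Measurable fun l : ℝ => ENNReal.ofReal (Real.exp (l * s)) := by fun_prop
  have hm' : Measurable fun l : ℝ => ENNReal.ofReal (Real.exp (l * s + l ^ 2 / 2)) := by fun_prop
  rw [gaussianReal_of_var_ne_zero _ (by positivity : (h + 1)⁻¹ ≠ 0),
    lintegral_withDensity_eq_lintegral_mul _ (measurable_gaussianPDF _ _) hm']
  have e : ∀ l, (gaussianPDF 0 (h + 1)⁻¹
        * fun l => ENNReal.ofReal (Real.exp (l * s + l ^ 2 / 2))) l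
      = ENNReal.ofReal (√((h + 1) / h))
        * (gaussianPDF 0 h⁻¹ * fun l => ENNReal.ofReal (Real.exp (l * s))) l := by
    intro l
    simp only [Pi.mul_apply, gaussianPDF]
    rw [← ENNReal.ofReal_mul (gaussianPDFReal_nonneg _ _ _), hpdf l,
      ENNReal.ofReal_mul (Real.sqrt_nonneg _),
      ENNReal.ofReal_mul (gaussianPDFReal_nonneg _ _ _)]
  rw [lintegral_congr e, lintegral_const_mul _ ((measurable_gaussianPDF _ _).mul hm),
    ← lintegral_withDensity_eq_lintegral_mul _ (measurable_gaussianPDF _ _) hm,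
    ← gaussianReal_of_var_ne_zero _ (by positivity : h⁻¹ ≠ 0),
    lintegral_exp_mul_gaussianReal, ← ENNReal.ofReal_mul (Real.sqrt_nonneg _)]
  congr 3
  rw [NNReal.coe_inv]
  have hh' : (0 : ℝ) < h := by exact_mod_cast hh
  field_simp

/-- A square-exponential moment of a sub-Gaussian law, obtained by writing the exponential of a
square as a Gaussian mixture of exponentials. -/
lemma lintegral_exp_sq_le {ρ : Measure ℝ} [IsProbabilityMeasure ρ] (hρ : IsOneSubGaussian ρ)
    {h : ℝ} (hh : 0 < h) (s : ℝ) :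
    ∫⁻ x, ENNReal.ofReal (Real.exp ((s + (x - ∫ y, y ∂ρ)) ^ 2 / (2 * (h + 1)))) ∂ρ
      ≤ ENNReal.ofReal (√((h + 1) / h) * Real.exp (s ^ 2 / (2 * h))) := by
  lift h to ℝ≥0 using hh.le
  have hh' : 0 < h := by exact_mod_cast hh
  set m := ∫ y, y ∂ρ
  have e : ∀ x : ℝ, ENNReal.ofReal (Real.exp ((s + (x - m)) ^ 2 / (2 * (h + 1))))
      = ∫⁻ l, ENNReal.ofReal (Real.exp (l * (s + (x - m)))) ∂(gaussianReal 0 (h + 1)⁻¹) := by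
    intro x
    rw [lintegral_exp_mul_gaussianReal]
    congr 2
    push_cast
    field_simp
  rw [lintegral_congr e, lintegral_lintegral_swap, ← lintegral_exp_tilt hh']
  · refine lintegral_mono fun l => ?_
    have e' : ∀ x : ℝ, ENNReal.ofReal (Real.exp (l * (s + (x - m))))
        = ENNReal.ofReal (Real.exp (l * s)) * ENNReal.ofReal (Real.exp (l * (x - m))) := by
      intro x
      rw [← ENNReal.ofReal_mul (Real.exp_pos _).le, ← Real.exp_add]
      congr 2; ring
    simp only [e']
    rw [lintegral_const_mul _ (by fun_prop), Real.exp_add,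
      ENNReal.ofReal_mul (Real.exp_pos _).le]
    gcongr
    rw [← ofReal_integral_eq_lintegral_ofReal (hρ.integrable_exp_mul l)
      (ae_of_all _ fun _ => (Real.exp_pos _).le)]
    have := hρ.mgf_le l
    simp only [NNReal.coe_one, one_mul] at this
    exact ENNReal.ofReal_le_ofReal this
  · exact (by fun_prop : Measurable (Function.uncurry fun (x l : ℝ) =>
      ENNReal.ofReal (Real.exp (l * (s + (x - m)))))).aemeasurable

/-- The uniform mixture, over the precisions `g = 4 ^ k / 2` with `k < L`, of
`∫ exp (l s - l ^ 2 N / 2)` with `l` centred Gaussian of variance `1 / g`. -/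
noncomputable def gaussMix (L : ℕ) (s : ℝ) (N : ℕ) : ℝ :=
  (∑ k ∈ Finset.range L, √((4 ^ k / 2) / (N + 4 ^ k / 2))
    * Real.exp (s ^ 2 / (2 * (N + 4 ^ k / 2)))) / L

lemma gaussMix_nonneg (L : ℕ) (s : ℝ) (N : ℕ) : 0 ≤ gaussMix L s N := by
  unfold gaussMix; positivity

lemma measurable_gaussMix (L : ℕ) : Measurable fun p : ℝ × ℕ => gaussMix L p.1 p.2 := by
  have : Measurable fun p : ℝ × ℕ => (p.2 : ℝ) := measurable_from_nat.comp measurable_snd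
  unfold gaussMix
  refine Measurable.div_const (Finset.measurable_sum _ fun k _ => ?_) _
  fun_prop

lemma measurable_ofReal_gaussMix {Ω : Type*} {m : MeasurableSpace Ω} {u : Ω → ℝ} {N : Ω → ℕ}
    (hu : Measurable u) (hN : Measurable N) (L : ℕ) :
    Measurable fun ω => ENNReal.ofReal (gaussMix L (u ω) (N ω)) := by
  have h : Measurable fun p : ℝ × ℕ => ENNReal.ofReal (gaussMix L p.1 p.2) :=
    (measurable_gaussMix L).ennreal_ofReal
  simpa only [Function.comp_def] using h.comp (hu.prodMk hN)

lemma gaussMix_zero {L : ℕ} (hL : 0 < L) : gaussMix L 0 0 = 1 := by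
  have hL' : (L : ℝ) ≠ 0 := by positivity
  simp [gaussMix, hL']

lemma lintegral_gaussMix_le {ρ : Measure ℝ} [IsProbabilityMeasure ρ] (hρ : IsOneSubGaussian ρ)
    (L : ℕ) (s : ℝ) (N : ℕ) :
    ∫⁻ x, ENNReal.ofReal (gaussMix L (s + (x - ∫ y, y ∂ρ)) (N + 1)) ∂ρ
      ≤ ENNReal.ofReal (gaussMix L s N) := by
  have e : ∀ (u : ℝ) (M : ℕ), ENNReal.ofReal (gaussMix L u M)
      = ∑ k ∈ Finset.range L, ENNReal.ofReal (√((4 ^ k / 2) / (M + 4 ^ k / 2)) / L)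
        * ENNReal.ofReal (Real.exp (u ^ 2 / (2 * (M + 4 ^ k / 2)))) := by
    intro u M
    simp only [← ENNReal.ofReal_mul (div_nonneg (Real.sqrt_nonneg _) (Nat.cast_nonneg L))]
    rw [← ENNReal.ofReal_sum_of_nonneg fun k _ => by positivity]
    congr 1
    rw [gaussMix, Finset.sum_div]
    exact Finset.sum_congr rfl fun k _ => by ring
  simp only [e]
  rw [lintegral_finsetSum _ fun k _ => by fun_prop]
  refine Finset.sum_le_sum fun k _ => ?_
  have hg : (0 : ℝ) < N + 4 ^ k / 2 := by positivity
  rw [lintegral_const_mul _ (by fun_prop)]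
  have h := lintegral_exp_sq_le hρ hg s
  have e2 : ((N + 1 : ℕ) : ℝ) + 4 ^ k / 2 = (N + 4 ^ k / 2) + 1 := by push_cast; ring
  rw [e2]
  refine (mul_le_mul_right h _).trans (le_of_eq ?_)
  rw [← ENNReal.ofReal_mul (by positivity), ← ENNReal.ofReal_mul (by positivity)]
  congr 1
  rw [div_mul_eq_mul_div, ← mul_assoc, ← Real.sqrt_mul (by positivity), div_mul_eq_mul_div]
  field_simp

/-- The precision `4 ^ k / 2` with `4 ^ k ≤ N < 4 ^ (k + 1)` loses a factor at most `3` in front of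
the exponential and at most `3 / 2` in the exponent. -/
lemma exp_le_gaussMix {L N : ℕ} (hN : 1 ≤ N) (hL : Nat.log 4 N < L) (s : ℝ) :
    Real.exp (s ^ 2 / N / 3) ≤ 3 * L * gaussMix L s N := by
  set k := Nat.log 4 N
  have h1 : ((4 : ℝ) ^ k) ≤ N := by exact_mod_cast Nat.pow_log_le_self 4 (by omega)
  have h2 : (N : ℝ) < 4 * 4 ^ k := by
    have := Nat.lt_pow_succ_log_self (b := 4) (by norm_num) N
    rw [pow_succ'] at this
    exact_mod_cast this
  have hN' : (0 : ℝ) < N := by positivity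
  have hL' : (0 : ℝ) < L := by exact_mod_cast (Nat.zero_le _).trans_lt hL
  have hterm : √((4 ^ k / 2) / (N + 4 ^ k / 2)) * Real.exp (s ^ 2 / (2 * (N + 4 ^ k / 2)))
      ≤ L * gaussMix L s N := by
    rw [gaussMix, mul_div_cancel₀ _ hL'.ne']
    exact Finset.single_le_sum (f := fun k : ℕ => √((4 ^ k / 2) / ((N : ℝ) + 4 ^ k / 2))
      * Real.exp (s ^ 2 / (2 * (N + 4 ^ k / 2)))) (fun i _ => by positivity)
      (Finset.mem_range.2 hL)
  have hsq : 1 / 3 ≤ √((4 ^ k / 2) / ((N : ℝ) + 4 ^ k / 2)) := by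
    refine Real.le_sqrt_of_sq_le ?_
    rw [le_div_iff₀ (by positivity)]
    linarith
  have hexp : Real.exp (s ^ 2 / N / 3) ≤ Real.exp (s ^ 2 / (2 * (N + 4 ^ k / 2))) := by
    rw [Real.exp_le_exp, div_div]
    refine div_le_div_of_nonneg_left (sq_nonneg s) (by positivity) ?_
    linarith
  have := mul_le_mul hsq hexp (Real.exp_pos _).le (Real.sqrt_nonneg _)
  linarith

end Mixture

/-! ### A maximal inequality and the concentration of the rewards -/

section Concentration

open scoped NNReal ENNReal

/-- A maximal inequality for nonnegative supermartingales, in terms of Lebesgue integrals. -/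
lemma mul_measure_exists_ge_le {Ω : Type*} {mΩ : MeasurableSpace Ω} {P : Measure Ω}
    {ℱ : Filtration ℕ mΩ} {Z : ℕ → Ω → ℝ≥0∞} (hZ : ∀ t, 1 ≤ t → Measurable[ℱ t] (Z t))
    (hstep : ∀ t, 1 ≤ t → ∀ A, MeasurableSet[ℱ t] A →
      ∫⁻ ω in A, Z (t + 1) ω ∂P ≤ ∫⁻ ω in A, Z t ω ∂P)
    (c : ℝ≥0∞) {n : ℕ} (hn : 1 ≤ n) :
    c * P {ω | ∃ t, 1 ≤ t ∧ t ≤ n ∧ c ≤ Z t ω} ≤ ∫⁻ ω, Z 1 ω ∂P := by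
  set G : ℕ → Set Ω := fun n => {ω | ∃ t, 1 ≤ t ∧ t ≤ n ∧ c ≤ Z t ω} with hG
  have hlev : ∀ t, 1 ≤ t → MeasurableSet[ℱ t] {ω | c ≤ Z t ω} := fun t ht =>
    hZ t ht measurableSet_Ici
  have hGm : ∀ n, MeasurableSet[ℱ n] (G n) := by
    intro n
    have e : G n = ⋃ t ∈ Finset.Icc 1 n, {ω | c ≤ Z t ω} := by
      ext ω; simp [hG, and_assoc]
    rw [e]
    refine Finset.measurableSet_biUnion _ fun t ht => ?_
    obtain ⟨h1, h2⟩ := Finset.mem_Icc.1 ht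
    exact ℱ.mono h2 _ (hlev t h1)
  suffices h : c * P (G n) + ∫⁻ ω in (G n)ᶜ, Z n ω ∂P ≤ ∫⁻ ω, Z 1 ω ∂P from
    le_self_add.trans h
  induction n, hn using Nat.le_induction with
  | base =>
    have hm := ℱ.le 1 _ (hGm 1)
    rw [← lintegral_add_compl (μ := P) (fun ω => Z 1 ω) hm, ← setLIntegral_const]
    refine add_le_add (setLIntegral_mono' hm fun ω hω => ?_) le_rfl
    obtain ⟨t, h1, h2, h⟩ := hω
    obtain rfl : t = 1 := by omega
    exact h
  | succ n hn ih =>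
    have hm := ℱ.le n _ (hGm n)
    have hl := ℱ.le (n + 1) _ (hlev (n + 1) (by omega))
    set E := {ω | c ≤ Z (n + 1) ω}
    have e : G (n + 1) = G n ∪ ((G n)ᶜ ∩ E) := by
      ext ω
      constructor
      · rintro ⟨t, h1, h2, h⟩
        by_cases hω : ω ∈ G n
        · exact Or.inl hω
        · refine Or.inr ⟨hω, ?_⟩
          rcases h2.eq_or_lt with rfl | hlt
          · exact h
          · exact absurd ⟨t, h1, by omega, h⟩ hω
      · rintro (⟨t, h1, h2, h⟩ | ⟨-, h⟩)
        · exact ⟨t, h1, by omega, h⟩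
        · exact ⟨n + 1, by omega, le_rfl, h⟩
    have e' : (G (n + 1))ᶜ = (G n)ᶜ \ E := by
      rw [e]; ext ω; simp only [Set.mem_compl_iff, Set.mem_union, Set.mem_inter_iff,
        Set.mem_sdiff]; tauto
    refine le_trans ?_ ih
    calc c * P (G (n + 1)) + ∫⁻ ω in (G (n + 1))ᶜ, Z (n + 1) ω ∂P
        ≤ c * (P (G n) + P ((G n)ᶜ ∩ E)) + ∫⁻ ω in (G n)ᶜ \ E, Z (n + 1) ω ∂P := by
          rw [e', e]; gcongr; exact measure_union_le _ _
      _ = c * P (G n) + (c * P ((G n)ᶜ ∩ E) + ∫⁻ ω in (G n)ᶜ \ E, Z (n + 1) ω ∂P) := by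
          rw [mul_add, add_assoc]
      _ ≤ c * P (G n) + (∫⁻ ω in (G n)ᶜ ∩ E, Z (n + 1) ω ∂P
            + ∫⁻ ω in (G n)ᶜ \ E, Z (n + 1) ω ∂P) := by
          rw [← setLIntegral_const ((G n)ᶜ ∩ E)]
          exact add_le_add le_rfl (add_le_add
            (setLIntegral_mono' (hm.compl.inter hl) fun ω hω => hω.2) le_rfl)
      _ = c * P (G n) + ∫⁻ ω in (G n)ᶜ, Z (n + 1) ω ∂P := by
          rw [lintegral_inter_add_sdiff _ _ hl]
      _ ≤ _ := add_le_add le_rfl (hstep n hn _ (hGm n).compl)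

/-- Integration of a function of `(Y, X)` when `X` has law `ρ` and is independent of `Y`. -/
lemma lintegral_of_indep {Ω E F : Type*} [MeasurableSpace Ω] [MeasurableSpace E]
    [MeasurableSpace F] {Q : Measure Ω} [IsFiniteMeasure Q] {Y : Ω → E} {X : Ω → F}
    {ρ : Measure F} [IsProbabilityMeasure ρ] (hY : Measurable Y) (hX : Measurable X)
    (h : ∀ A B, MeasurableSet A → MeasurableSet B →
      Q (Y ⁻¹' A ∩ X ⁻¹' B) = Q (Y ⁻¹' A) * ρ B)
    {f : E × F → ℝ≥0∞} (hf : Measurable f) :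
    ∫⁻ ω, f (Y ω, X ω) ∂Q = ∫⁻ ω, ∫⁻ x, f (Y ω, x) ∂ρ ∂Q := by
  have e : Q.map (fun ω => (Y ω, X ω)) = (Q.map Y).prod ρ := by
    have : IsFiniteMeasure (Q.map fun ω => (Y ω, X ω)) := inferInstance
    refine Measure.ext_prod fun {A B} hA hB => ?_
    rw [Measure.map_apply (hY.prodMk hX) (hA.prod hB), Measure.prod_prod,
      Measure.map_apply hY hA]
    exact h A B hA hB
  rw [← lintegral_map hf (hY.prodMk hX), e, lintegral_prod _ hf.aemeasurable,
    lintegral_map hf.lintegral_prod_right' hY]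

variable {K : ℕ} {ε₀ β : ℝ} {ν : Fin K → Measure ℝ} {Ω : Type*} {mΩ : MeasurableSpace Ω}
  {P : Measure Ω} {ℱ : Filtration ℕ mΩ} {arm : ℕ → Ω → Fin K} {rew : ℕ → Ω → ℝ}
  {lead chal : ℕ → Ω → Fin K}

lemma pulls_eq_sum (arm : ℕ → Fin K) (n : ℕ) (a : Fin K) :
    pulls arm n a = ∑ t ∈ Finset.Ico 1 n, if arm t = a then 1 else 0 :=
  Finset.card_filter _ _

lemma devSum_succ (μ : Fin K → ℝ) (arm : ℕ → Fin K) (rew : ℕ → ℝ) {n : ℕ} (hn : 1 ≤ n)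
    (a : Fin K) : devSum μ arm rew (n + 1) a
      = devSum μ arm rew n a + if arm n = a then rew n - μ a else 0 := by
  simp only [devSum, Finset.sum_filter]
  exact Finset.sum_Ico_succ_top hn _

lemma Interaction.measurableSet_arm (h : Interaction ε₀ β ν P ℱ arm rew lead chal) {s t : ℕ}
    (hs : 1 ≤ s) (hst : s ≤ t) (a : Fin K) : MeasurableSet[ℱ t] {ω | arm s ω = a} :=
  ℱ.mono hst _ (h.arm_meas s hs (measurableSet_singleton a))

lemma Interaction.measurable_pulls (h : Interaction ε₀ β ν P ℱ arm rew lead chal) (t : ℕ)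
    (a : Fin K) : Measurable[ℱ t] fun ω => pulls (fun s => arm s ω) t a := by
  simp only [pulls_eq_sum]
  refine Finset.measurable_sum _ fun s hs => ?_
  obtain ⟨h1, h2⟩ := Finset.mem_Ico.1 hs
  exact Measurable.ite (h.measurableSet_arm h1 h2.le a) measurable_const measurable_const

lemma Interaction.measurable_devSum (h : Interaction ε₀ β ν P ℱ arm rew lead chal)
    (μ : Fin K → ℝ) (t : ℕ) (a : Fin K) :
    Measurable[ℱ t] fun ω => devSum μ (fun s => arm s ω) (fun s => rew s ω) t a := by
  simp only [devSum, Finset.sum_filter]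
  refine Finset.measurable_sum _ fun s hs => ?_
  obtain ⟨h1, h2⟩ := Finset.mem_Ico.1 hs
  refine Measurable.ite (h.measurableSet_arm h1 h2.le a) ?_ measurable_const
  exact ((h.rew_meas s h1).mono (ℱ.mono h2) le_rfl).sub_const _

/-- On an event of the past on which arm `a` is pulled, the reward is independent of the past and
has law `ν a`. -/
lemma Interaction.measure_inter_preimage [IsProbabilityMeasure P]
    (h : Interaction ε₀ β ν P ℱ arm rew lead chal) (hν : ∀ k, IsProbabilityMeasure (ν k))
    {t : ℕ} (ht : 1 ≤ t) {a : Fin K} {D : Set Ω} (hD : MeasurableSet[ℱ t] D)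
    (hDa : ∀ ω ∈ D, arm t ω = a) {B : Set ℝ} (hB : MeasurableSet B) :
    P (D ∩ rew t ⁻¹' B) = P D * ν a B := by
  have hX : Measurable (rew t) := (h.rew_meas t ht).mono (ℱ.le _) le_rfl
  have hD' := ℱ.le t _ hD
  have hreal : P.real (D ∩ rew t ⁻¹' B) = P.real D * (ν a).real B := by
    have h1 := setIntegral_condExp (μ := P) (ℱ.le t)
      (f := (rew t ⁻¹' B).indicator fun _ => (1 : ℝ))
      ((integrable_const (1 : ℝ)).indicator (hX hB)) hD
    rw [setIntegral_indicator (hX hB), setIntegral_const, smul_eq_mul, mul_one] at h1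
    rw [← h1, setIntegral_congr_ae (g := fun _ => (ν a).real B) hD', setIntegral_const,
      smul_eq_mul]
    filter_upwards [h.rew_law t ht B hB] with ω hω hωD
    rw [hω, hDa ω hωD]
  have := congrArg ENNReal.ofReal hreal
  rwa [ENNReal.ofReal_mul measureReal_nonneg, ofReal_measureReal, ofReal_measureReal,
    ofReal_measureReal] at this

/-- The nonnegative supermartingale attached to arm `a`. -/
noncomputable def armMix (μ : Fin K → ℝ) (L : ℕ) (arm : ℕ → Ω → Fin K) (rew : ℕ → Ω → ℝ)
    (a : Fin K) (t : ℕ) (ω : Ω) : ℝ≥0∞ :=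
  ENNReal.ofReal (gaussMix L (devSum μ (fun s => arm s ω) (fun s => rew s ω) t a)
    (pulls (fun s => arm s ω) t a))

lemma Interaction.measurable_armMix (h : Interaction ε₀ β ν P ℱ arm rew lead chal)
    (μ : Fin K → ℝ) (L t : ℕ) (a : Fin K) : Measurable[ℱ t] (armMix μ L arm rew a t) :=
  measurable_ofReal_gaussMix (h.measurable_devSum μ t a) (h.measurable_pulls t a) L

lemma armMix_succ_of_ne (μ : Fin K → ℝ) (L : ℕ) {a : Fin K} {t : ℕ} (ht : 1 ≤ t) {ω : Ω}
    (hω : arm t ω ≠ a) : armMix μ L arm rew a (t + 1) ω = armMix μ L arm rew a t ω := by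
  rw [armMix, armMix, devSum_succ _ _ _ ht, pulls_succ _ _ ht, if_neg hω, if_neg hω, add_zero,
    add_zero]

/-- The supermartingale property of `armMix` on the event that the arm is pulled, with a weight
`W` depending on the past. -/
lemma Interaction.setLIntegral_armMix_succ_le [IsProbabilityMeasure P]
    (h : Interaction ε₀ β ν P ℱ arm rew lead chal) (hν : ∀ k, IsProbabilityMeasure (ν k))
    (hsub : ∀ k, IsOneSubGaussian (ν k)) {μ : Fin K → ℝ} (hμ : ∀ k, μ k = ∫ x, x ∂(ν k))
    (L : ℕ) {t : ℕ} (ht : 1 ≤ t) {a : Fin K} {D : Set Ω} (hD : MeasurableSet[ℱ t] D)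
    (hDa : ∀ ω ∈ D, arm t ω = a) {W : Ω → ℝ≥0∞} (hW : Measurable[ℱ t] W) :
    ∫⁻ ω in D, armMix μ L arm rew a (t + 1) ω * W ω ∂P
      ≤ ∫⁻ ω in D, armMix μ L arm rew a t ω * W ω ∂P := by
  have hD' := ℱ.le t _ hD
  let Y : Ω → (ℝ × ℕ) × ℝ≥0∞ := fun ω =>
    ((devSum μ (fun s => arm s ω) (fun s => rew s ω) t a, pulls (fun s => arm s ω) t a), W ω)
  have hY : Measurable[ℱ t] Y :=
    ((h.measurable_devSum μ t a).prodMk (h.measurable_pulls t a)).prodMk hW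
  let f : ((ℝ × ℕ) × ℝ≥0∞) × ℝ → ℝ≥0∞ := fun p =>
    ENNReal.ofReal (gaussMix L (p.1.1.1 + (p.2 - ∫ y, y ∂(ν a))) (p.1.1.2 + 1)) * p.1.2
  have hN : Measurable fun n : ℕ => n + 1 := measurable_from_nat
  have hf : Measurable f := by
    refine Measurable.mul (measurable_ofReal_gaussMix ?_ ?_ L) (by fun_prop)
    · fun_prop
    · exact hN.comp (by fun_prop)
  have hind : ∀ A B, MeasurableSet A → MeasurableSet B →
      (P.restrict D) (Y ⁻¹' A ∩ rew t ⁻¹' B) = (P.restrict D) (Y ⁻¹' A) * ν a B := by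
    intro A B hA hB
    rw [Measure.restrict_apply' hD', Measure.restrict_apply' hD', Set.inter_right_comm]
    exact h.measure_inter_preimage hν ht ((hY hA).inter hD) (fun ω hω => hDa ω hω.2) hB
  have key := lintegral_of_indep (Q := P.restrict D) (ρ := ν a) (hY.mono (ℱ.le t) le_rfl)
    ((h.rew_meas t ht).mono (ℱ.le _) le_rfl) hind hf
  calc ∫⁻ ω in D, armMix μ L arm rew a (t + 1) ω * W ω ∂P
      = ∫⁻ ω in D, f (Y ω, rew t ω) ∂P := by
        refine setLIntegral_congr_fun hD' fun ω hω => ?_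
        simp only [f, Y]
        rw [armMix, devSum_succ _ _ _ ht, pulls_succ _ _ ht, if_pos (hDa ω hω),
          if_pos (hDa ω hω), hμ a]
    _ = ∫⁻ ω in D, ∫⁻ x, f (Y ω, x) ∂(ν a) ∂P := key
    _ ≤ _ := by
        refine lintegral_mono fun ω => ?_
        have hm : Measurable fun x : ℝ => ENNReal.ofReal (gaussMix L
            ((Y ω).1.1 + (x - ∫ y, y ∂(ν a))) ((Y ω).1.2 + 1)) :=
          measurable_ofReal_gaussMix (by fun_prop) measurable_const L
        simp only [f]
        rw [lintegral_mul_const _ hm]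
        exact mul_le_mul_left (lintegral_gaussMix_le (hsub a) L _ _) _

/-- The product of the supermartingales of two arms is a supermartingale, since only one arm is
pulled in each round. -/
lemma Interaction.setLIntegral_pair_succ_le [IsProbabilityMeasure P]
    (h : Interaction ε₀ β ν P ℱ arm rew lead chal) (hν : ∀ k, IsProbabilityMeasure (ν k))
    (hsub : ∀ k, IsOneSubGaussian (ν k)) {μ : Fin K → ℝ} (hμ : ∀ k, μ k = ∫ x, x ∂(ν k))
    (L : ℕ) {a b : Fin K} (hab : a ≠ b) {t : ℕ} (ht : 1 ≤ t) {A : Set Ω}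
    (hA : MeasurableSet[ℱ t] A) :
    ∫⁻ ω in A, armMix μ L arm rew a (t + 1) ω * armMix μ L arm rew b (t + 1) ω ∂P
      ≤ ∫⁻ ω in A, armMix μ L arm rew a t ω * armMix μ L arm rew b t ω ∂P := by
  have ha := h.measurableSet_arm ht le_rfl a
  have hb := h.measurableSet_arm ht le_rfl b
  have ha' := ℱ.le t _ ha
  have hb' := ℱ.le t _ hb
  have hA' := ℱ.le t _ hA
  rw [← lintegral_inter_add_sdiff _ A ha', ← lintegral_inter_add_sdiff _ A ha',
    ← lintegral_inter_add_sdiff _ (A \ _) hb', ← lintegral_inter_add_sdiff _ (A \ _) hb']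
  refine add_le_add ?_ (add_le_add ?_ (le_of_eq ?_))
  · rw [setLIntegral_congr_fun (hA'.inter ha')
      (g := fun ω => armMix μ L arm rew a (t + 1) ω * armMix μ L arm rew b t ω)]
    · exact h.setLIntegral_armMix_succ_le hν hsub hμ L ht (hA.inter ha) (fun ω hω => hω.2)
        (h.measurable_armMix μ L t b)
    · intro ω hω
      have : arm t ω ≠ b := fun e => hab (hω.2.symm.trans e)
      simp only [armMix_succ_of_ne μ L ht this]
  · simp only [mul_comm (armMix μ L arm rew a _ _)]
    rw [setLIntegral_congr_fun ((hA'.diff ha').inter hb')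
      (g := fun ω => armMix μ L arm rew b (t + 1) ω * armMix μ L arm rew a t ω)]
    · exact h.setLIntegral_armMix_succ_le hν hsub hμ L ht ((hA.diff ha).inter hb)
        (fun ω hω => hω.2) (h.measurable_armMix μ L t a)
    · intro ω hω
      have : arm t ω ≠ a := hω.1.2
      simp only [armMix_succ_of_ne μ L ht this]
  · refine setLIntegral_congr_fun ((hA'.diff ha').diff hb') fun ω hω => ?_
    have h1 : arm t ω ≠ a := hω.1.2
    have h2 : arm t ω ≠ b := hω.2
    simp only [armMix_succ_of_ne μ L ht h1, armMix_succ_of_ne μ L ht h2]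

/-- Concentration of a pair of arms, uniformly in time: when the sum of the two squared deviations
reaches `3 x`, the product of the two mixtures reaches `exp x / (3 L) ^ 2`. -/
lemma Interaction.measure_pair_le [IsProbabilityMeasure P]
    (h : Interaction ε₀ β ν P ℱ arm rew lead chal) (hν : ∀ k, IsProbabilityMeasure (ν k))
    (hsub : ∀ k, IsOneSubGaussian (ν k)) {μ : Fin K → ℝ} (hμ : ∀ k, μ k = ∫ x, x ∂(ν k))
    {a b : Fin K} (hab : a ≠ b) {n : ℕ} (hn : 1 ≤ n) (x : ℝ) :
    P.real {ω | ∃ t, K < t ∧ t ≤ n ∧ 3 * x ≤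
        devSum μ (fun s => arm s ω) (fun s => rew s ω) t a ^ 2 / pulls (fun s => arm s ω) t a
        + devSum μ (fun s => arm s ω) (fun s => rew s ω) t b ^ 2 / pulls (fun s => arm s ω) t b}
      ≤ (3 * (Nat.log 4 n + 1)) ^ 2 * Real.exp (-x) := by
  set L := Nat.log 4 n + 1 with hL
  have hmax := mul_measure_exists_ge_le (P := P) (ℱ := ℱ)
    (Z := fun t ω => armMix μ L arm rew a t ω * armMix μ L arm rew b t ω)
    (fun t _ => (h.measurable_armMix μ L t a).mul (h.measurable_armMix μ L t b))
    (fun t ht A hA => h.setLIntegral_pair_succ_le hν hsub hμ L hab ht hA)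
    (ENNReal.ofReal (Real.exp x / (3 * L) ^ 2)) hn
  have hone : ∀ k ω, armMix μ L arm rew k 1 ω = 1 := fun k ω => by
    simp [armMix, devSum, pulls, gaussMix_zero (Nat.succ_pos _), hL]
  simp only [hone, mul_one, lintegral_const, measure_univ] at hmax
  have hLpos : (0 : ℝ) < 3 * L := by positivity
  have hsubset : {ω | ∃ t, K < t ∧ t ≤ n ∧ 3 * x ≤
        devSum μ (fun s => arm s ω) (fun s => rew s ω) t a ^ 2 / pulls (fun s => arm s ω) t a
        + devSum μ (fun s => arm s ω) (fun s => rew s ω) t b ^ 2 / pulls (fun s => arm s ω) t b}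
      ⊆ {ω | ∃ t, 1 ≤ t ∧ t ≤ n ∧ ENNReal.ofReal (Real.exp x / (3 * L) ^ 2)
        ≤ armMix μ L arm rew a t ω * armMix μ L arm rew b t ω} := by
    rintro ω ⟨t, h1, h2, h3⟩
    refine ⟨t, by omega, h2, ?_⟩
    have hb : ∀ k, Real.exp (devSum μ (fun s => arm s ω) (fun s => rew s ω) t k ^ 2
        / pulls (fun s => arm s ω) t k / 3) ≤ 3 * L * gaussMix L
          (devSum μ (fun s => arm s ω) (fun s => rew s ω) t k)
          (pulls (fun s => arm s ω) t k) := fun k => by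
      refine exp_le_gaussMix ((h.follows ω).pulls_pos h1 k) ?_ _
      have := pulls_lt (fun s => arm s ω) k (t := t) (by omega)
      exact Nat.lt_succ_of_le (Nat.log_mono_right (by omega))
    rw [armMix, armMix, ← ENNReal.ofReal_mul (gaussMix_nonneg _ _ _)]
    refine ENNReal.ofReal_le_ofReal ?_
    have hmul := mul_le_mul (hb a) (hb b) (Real.exp_pos _).le
      (mul_nonneg hLpos.le (gaussMix_nonneg _ _ _))
    rw [← Real.exp_add] at hmul
    rw [div_le_iff₀ (by positivity)]
    refine (Real.exp_le_exp.2 ?_).trans (hmul.trans (le_of_eq (by ring)))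
    linarith
  have hfin := (mul_le_mul_right (measure_mono hsubset) _).trans hmax
  rw [← ofReal_measureReal, ← ENNReal.ofReal_mul (by positivity), ← ENNReal.ofReal_one,
    ENNReal.ofReal_le_ofReal_iff (by norm_num)] at hfin
  rw [Real.exp_neg, ← div_eq_mul_inv, le_div_iff₀ (Real.exp_pos _)]
  rw [div_mul_eq_mul_div, div_le_one (by positivity)] at hfin
  have e : (L : ℝ) = Nat.log 4 n + 1 := by rw [hL]; push_cast; rfl
  rw [← e]
  linarith

lemma Interaction.measure_not_concentrated_le [IsProbabilityMeasure P]
    (h : Interaction ε₀ β ν P ℱ arm rew lead chal) (hν : ∀ k, IsProbabilityMeasure (ν k))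
    (hsub : ∀ k, IsOneSubGaussian (ν k)) {μ : Fin K → ℝ} (hμ : ∀ k, μ k = ∫ x, x ∂(ν k))
    {n : ℕ} (hn : 1 ≤ n) (x : ℝ) :
    P.real {ω | ¬ ∀ t, K < t → t ≤ n →
        Concentrated μ x (fun s => arm s ω) (fun s => rew s ω) t}
      ≤ K ^ 2 * ((3 * (Nat.log 4 n + 1)) ^ 2 * Real.exp (-x)) := by
  let S := (Finset.univ : Finset (Fin K × Fin K)).filter fun p => p.1 ≠ p.2
  let E : Fin K × Fin K → Set Ω := fun p => {ω | ∃ t, K < t ∧ t ≤ n ∧ 3 * x ≤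
        devSum μ (fun s => arm s ω) (fun s => rew s ω) t p.1 ^ 2
          / pulls (fun s => arm s ω) t p.1
        + devSum μ (fun s => arm s ω) (fun s => rew s ω) t p.2 ^ 2
          / pulls (fun s => arm s ω) t p.2}
  have hsubset : {ω | ¬ ∀ t, K < t → t ≤ n →
      Concentrated μ x (fun s => arm s ω) (fun s => rew s ω) t} ⊆ ⋃ p ∈ S, E p := by
    intro ω hω
    simp only [Concentrated, Set.mem_ofPred_eq] at hω
    push Not at hω
    obtain ⟨t, h1, h2, a, b, hab, h3⟩ := hω
    exact Set.mem_biUnion (x := (a, b)) (by simpa [S] using hab) ⟨t, h1, h2, h3⟩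
  calc _ ≤ P.real (⋃ p ∈ S, E p) := measureReal_mono hsubset (measure_ne_top _ _)
    _ ≤ ∑ p ∈ S, P.real (E p) := measureReal_biUnion_finset_le _ _
    _ ≤ ∑ p ∈ S, ((3 * (Nat.log 4 n + 1)) ^ 2 * Real.exp (-x)) :=
        Finset.sum_le_sum fun p hp =>
          h.measure_pair_le hν hsub hμ (Finset.mem_filter.1 hp).2 hn x
    _ = S.card * ((3 * (Nat.log 4 n + 1)) ^ 2 * Real.exp (-x)) := by
        rw [Finset.sum_const, nsmul_eq_mul]
    _ ≤ _ := by
        gcongr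
        have : S.card ≤ K * K := (Finset.card_filter_le _ _).trans (by simp)
        rw [sq]
        exact_mod_cast this

end Concentration

/-! ### The error probability -/

section Error

lemma log_four_bound {n : ℕ} (hn : 1 ≤ n) :
    (3 * ((Nat.log 4 n : ℝ) + 1)) ^ 2 ≤ Real.exp 1 ^ 2 * (2 + Real.log n) ^ 2 := by
  rw [← mul_pow]
  refine pow_le_pow_left₀ (by positivity) ?_ 2
  have hlog : (Nat.log 4 n : ℝ) * Real.log 4 ≤ Real.log n := by
    rw [← Real.log_pow]
    refine Real.log_le_log (by positivity) ?_
    exact_mod_cast Nat.pow_log_le_self 4 (by omega)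
  have h4 : Real.log 4 = 2 * Real.log 2 := by
    rw [show (4 : ℝ) = 2 ^ 2 by norm_num, Real.log_pow]; norm_num
  have h2 := Real.log_two_gt_d9
  have he := Real.exp_one_gt_d9
  have hL : (0 : ℝ) ≤ Nat.log 4 n := by positivity
  have hn0 : 0 ≤ Real.log n := Real.log_natCast_nonneg n
  have : (Nat.log 4 n : ℝ) * 1.38 ≤ Real.log n :=
    (mul_le_mul_of_nonneg_left (by linarith) hL).trans hlog
  nlinarith

lemma exp_neg_pFun_of_one_le {x : ℝ} (hx : 1 ≤ x) :
    Real.exp (-pFun x) = x * Real.exp (-x) := by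
  rw [pFun, max_eq_left hx, neg_sub, sub_eq_add_neg, Real.exp_add, Real.exp_log (by linarith)]

variable {K : ℕ} {ε₀ : ℝ} {ν : Fin K → Measure ℝ} {Ω : Type*} {mΩ : MeasurableSpace Ω}
  {P : Measure Ω} {ℱ : Filtration ℕ mΩ} {arm : ℕ → Ω → Fin K} {rew : ℕ → Ω → ℝ}
  {lead chal : ℕ → Ω → Fin K}

lemma Interaction.measure_error_le [Nonempty (Fin K)] [IsProbabilityMeasure P]
    (h : Interaction ε₀ (1 / 2) ν P ℱ arm rew lead chal) (hK : 2 ≤ K) (hε₀ : 0 < ε₀)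
    (hν : ∀ k, IsProbabilityMeasure (ν k))
    (hsub : ∀ k, IsOneSubGaussian (ν k)) {μ : Fin K → ℝ} (hμ : ∀ k, μ k = ∫ x, x ∂(ν k))
    {n : ℕ} (hn : 5 * (K : ℝ) ^ 2 / 2 < n) {ε : ℝ} {i : ℕ} (h1 : 1 ≤ i)
    (hi : i < numGroups μ) (hε : gap μ i ≤ ε) :
    P.real {ω | lead n ω ∉ goodArms μ ε} ≤
      (K : ℝ) ^ 2 * Real.exp 1 ^ 2 * (2 + Real.log n) ^ 2 *
        Real.exp (-pFun (((n : ℝ) - 5 * (K : ℝ) ^ 2 / 2) / (8 * complexity μ ε₀ i))) := by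
  have hK' : (2 : ℝ) ≤ K := by exact_mod_cast hK
  have hn1 : 1 ≤ n := by
    by_contra! h0
    obtain rfl : n = 0 := by omega
    norm_num at hn
    nlinarith
  have hlog : 0 ≤ Real.log n := Real.log_natCast_nonneg n
  set H := complexity μ ε₀ i
  have hH : 0 < H := by
    have hg : 0 < gap μ (i + 1) := gap_pos (by omega) hi
    exact lt_of_lt_of_le (by positivity) (gap_inv_le_complexity hε₀ h1 hi)
  set x := ((n : ℝ) - 5 * (K : ℝ) ^ 2 / 2) / (8 * H) with hx
  have hx0 : 0 < x := div_pos (by linarith) (by positivity)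
  rcases le_total 1 x with hx1 | hx1
  · have hsubset : {ω | lead n ω ∉ goodArms μ ε} ⊆ {ω | ¬ ∀ t, K < t → t ≤ n →
        Concentrated μ x (fun s => arm s ω) (fun s => rew s ω) t} := by
      intro ω hω hc
      have hbad : gap μ i < bestMean μ - μ (lead n ω) := by
        have : ¬ bestMean μ - ε ≤ μ (lead n ω) := hω
        linarith [not_le.1 this]
      have := (h.follows ω).lt_of_bad hK hε₀ hx0 h1 hi hc hbad
      rw [hx, mul_div_cancel₀ _ (by positivity)] at this
      linarith
    refine (measureReal_mono hsubset).trans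
      ((h.measure_not_concentrated_le hν hsub hμ hn1 x).trans ?_)
    rw [exp_neg_pFun_of_one_le hx1, mul_assoc ((K : ℝ) ^ 2), mul_assoc ((K : ℝ) ^ 2)]
    gcongr
    · exact log_four_bound hn1
    · exact le_mul_of_one_le_left (Real.exp_pos _).le hx1
  · -- for `x ≤ 1` the bound is at least `1`
    refine measureReal_le_one.trans ?_
    have he : Real.exp 1 ^ 2 * Real.exp (-1) = Real.exp 1 := by
      rw [sq, mul_assoc, ← Real.exp_add]; norm_num
    rw [pFun, max_eq_right hx1, Real.log_one, sub_zero]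
    have e1 : (1 : ℝ) ≤ Real.exp 1 := Real.one_le_exp (by norm_num)
    have e2 : (1 : ℝ) ≤ (K : ℝ) ^ 2 := one_le_pow₀ (by linarith)
    have e3 : (1 : ℝ) ≤ (2 + Real.log n) ^ 2 := one_le_pow₀ (by linarith)
    calc (1 : ℝ) ≤ (K : ℝ) ^ 2 * (2 + Real.log n) ^ 2 * Real.exp 1 :=
          one_le_mul_of_one_le_of_one_le (one_le_mul_of_one_le_of_one_le e2 e3) e1
      _ = _ := by linear_combination (-((K : ℝ) ^ 2 * (2 + Real.log n) ^ 2)) * he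

end Error

end EBTC

theorem theorem3 (K : ℕ) (hK : 2 ≤ K) (ε₀ : ℝ) (hε₀ : 0 < ε₀) (μ : Fin K → ℝ) :
    (2 ≤ EBTC.numGroups μ →
      EBTC.complexity μ ε₀ 1 = (K : ℝ) * (2 * (EBTC.gap μ 2)⁻¹ + 3 * ε₀⁻¹) ^ 2 ∧
      EBTC.detailedComplexity μ ε₀ 1 = (K : ℝ) * (2 * (EBTC.gap μ 2)⁻¹ + 3 * ε₀⁻¹) ^ 2) ∧
    (∀ i : ℕ, 1 < i → i < EBTC.numGroups μ →
      (K : ℝ) * ((EBTC.gap μ (i + 1))⁻¹) ^ 2 ≤ EBTC.complexity μ ε₀ i ∧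
      EBTC.complexity μ ε₀ i ≤ (K : ℝ) * ⨅ j : Finset.Icc 1 i,
        (max (2 * (EBTC.gap μ ((j : ℕ) + 1))⁻¹)
          (2 * ((EBTC.gap μ j / ε₀ + 1) / (EBTC.gap μ (i + 1) - EBTC.gap μ j))
            + 3 * ε₀⁻¹)) ^ 2 ∧
      EBTC.complexity μ ε₀ i ≤ EBTC.detailedComplexity μ ε₀ i ∧
      EBTC.detailedComplexity μ ε₀ i ≤ 3 / 2 * EBTC.complexity μ ε₀ i) ∧
    (∀ (ν : Fin K → Measure ℝ), (∀ k, IsProbabilityMeasure (ν k)) →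
      (∀ k, EBTC.IsOneSubGaussian (ν k)) → (∀ k, μ k = ∫ x, x ∂(ν k)) →
      ∀ (Ω : Type*) [mΩ : MeasurableSpace Ω] (P : Measure Ω) [IsProbabilityMeasure P]
        (ℱ : Filtration ℕ mΩ) (arm : ℕ → Ω → Fin K) (rew : ℕ → Ω → ℝ)
        (lead chal : ℕ → Ω → Fin K),
        EBTC.Interaction ε₀ (1 / 2) ν P ℱ arm rew lead chal →
        ∀ (ε : ℝ), 0 ≤ ε → ∀ (n : ℕ), 5 * (K : ℝ) ^ 2 / 2 < (n : ℝ) →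
          (∀ i : ℕ, 1 ≤ i → i < EBTC.numGroups μ →
            EBTC.gap μ i ≤ ε → ε < EBTC.gap μ (i + 1) →
            P.real {ω | lead n ω ∉ EBTC.goodArms μ ε} ≤
              (K : ℝ) ^ 2 * Real.exp 1 ^ 2 * (2 + Real.log n) ^ 2 *
                Real.exp (-EBTC.pFun
                  (((n : ℝ) - 5 * (K : ℝ) ^ 2 / 2) / (8 * EBTC.complexity μ ε₀ i)))) ∧
          (EBTC.gap μ (EBTC.numGroups μ) ≤ ε →
            P.real {ω | lead n ω ∉ EBTC.goodArms μ ε} = 0)) := by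
  have : Nonempty (Fin K) := ⟨⟨0, by omega⟩⟩
  refine ⟨EBTC.complexity_one hε₀, fun i h1 hi => ⟨EBTC.gap_inv_le_complexity hε₀ h1.le hi,
    min_le_right _ _, min_le_left _ _, EBTC.detailedComplexity_le hε₀ h1.le hi⟩, ?_⟩
  intro ν hν hsub hμ Ω mΩ P _ ℱ arm rew lead chal h ε _ n hn
  refine ⟨fun i h1 hi hε _ => h.measure_error_le hK hε₀ hν hsub hμ hn h1 hi hε, fun hε => ?_⟩
  have hempty : {ω | lead n ω ∉ EBTC.goodArms μ ε} = ∅ := by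
    refine Set.eq_empty_of_forall_notMem fun ω hω => hω ?_
    have := EBTC.sub_le_gap_last μ (lead n ω)
    change EBTC.bestMean μ - ε ≤ μ (lead n ω)
    linarith
  rw [hempty, measureReal_empty]
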